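/- Throughout, $\mathbb N=\{1,2,\dots\}$, and Banach spaces are real. **Schreier families.** For finite sets $F,G\subseteq\mathbb N$ write $F<G$ if every element of $F$ is smaller than every element of $G$, and $F\ge n$ if all elements of $F$ are $\ge n$. Put $\mathcal S_0=\{\{n\}:n\in\mathbb N\}\cup\{\emptyset\}$ and $\mathcal S_1=\{F:|F|\le\min F\}\cup\{\emptyset\}$. For $\alpha<\omega_1$ let $\mathcal S_{\alpha+1}=\mathcal S_1[\mathcal S_\alpha]$, where $\mathcal F[\mathcal G]$ is the family of all unions $\bigcup_{i=1}^nG_i$ of nonempty sets $G_1<\dots<G_n$ in $\mathcal G$ with $\{\min G_1,\dots,\min G_n\}\in\mathcal F$. For a limit ordinal $\alpha<\omega_1$, choose ordinals $\alpha_n<\alpha$ with $\alpha_n\uparrow\alpha$ and let $\mathcal S_\alpha=\{F: F\in\mathcal S_{\alpha_n}\text{ and }F\ge n\text{ for some }n\in\mathbb N\}$. The choices of the sequences $(\alpha_n)$ are arbitrary but fixed. **Block bases.** For a basic sequence $(x_i)$, $(y_i)\prec(x_i)$ means that $(y_i)$ is a (finite or infinite) block basis of $(x_i)$, i.e. the $y_i$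 are finite linear combinations of the $x_j$ whose supports with respect to $(x_j)$ are nonempty and satisfy $\operatorname{supp}y_1<\operatorname{supp}y_2<\cdots$. A finite block basis $(y_i)_1^k\prec(x_i)$ is $\alpha$-admissible with respect to $(x_i)$ if $\{\min\operatorname{supp}y_i:i\le k\}\in\mathcal S_\alpha$. **Asymptotic constants.** For a basic sequence $(x_i)$ and a norm $|\cdot|$ on its closed linear span $[x_i]$ equivalent to the given one, let $\delta_\alpha((x_i),|\cdot|)$ be the supremum of all $\delta\ge0$ such that $|\sum_{i=1}^ky_i|\ge\delta\sum_{i=1}^k|y_i|$ for every $(y_i)_1^k\prec(x_i)$ that is $\alpha$-admissible with respect to $(x_i)$. Put $\dot\delta_\alpha((x_i),|\cdot|)=\sup\{\delta_\alpha((z_i),|\cdot|):(z_i)\prec(x_i)\}$, where $(z_i)$ ranges over infinite block bases, and $\ddot\delta_\alpha(x_i)=\sup\{\dot\delta_\alpha((x_i),|\cdot|): |\cdot|\text{ an equivalent norm on }[x_i]\}$. For the original norm write $\delta_\alpha(x_i)$. **Spectrum.** A basic sequence $(x_i)$ *$\Delta$-stabilizes* a family $\gamma=(\gamma_\alpha)_{\alpha<\omega_1}$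 of real numbers if there are $\varepsilon_n\downarrow0$ such that for every $\alpha<\omega_1$ there is $m\in\mathbb N$ such that $|\delta_\alpha(y_i)-\gamma_\alpha|<\varepsilon_n$ for all $n\ge m$ and all infinite block bases $(y_i)\prec(x_i)_{i\ge n}$. For a space $X$ with a basis $(e_i)$, $\Delta(X)$ is the set of all $\gamma$ that are $\Delta$-stabilized by some infinite block basis $(x_i)\prec(e_i)$. **Proposition.** Let $X$ be a Banach space with a (Schauder) basis $(e_i)_{i\in\mathbb N}$ and let $\gamma\in\Delta(X)$. Then there exists an infinite block basis $(y_i)\prec(e_i)$ such that $(y_i)$ $\Delta$-stabilizes $\gamma$ and such that for all $\alpha<\omega_1$ the limit $\lim_n(\gamma_{\alpha\cdot n})^{1/n}$ exists and $$\ddot\delta_\alpha(y_i)=\lim_{n\to\infty}(\gamma_{\alpha\cdot n})^{1/n}.$$ -/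

import Mathlib

/-!
# Asymptotic `ℓ₁` constants and the `Δ`-spectrum of a Banach space with a basis

All sequences `(x_1, x_2, …)` are indexed by `ℕ = {0, 1, 2, …}`, so the vector at index `k`
is the `(k+1)`-st vector.  Accordingly, every family of finite subsets of `{1, 2, 3, …}` is
represented by its image under the order isomorphism `k ↦ k - 1` onto `{0, 1, 2, …}`.
-/

open Filter Topology
open scoped Ordinal

noncomputable section

namespace AsymptoticL1

/-! ### Finite subsets of `ℕ` and the Schreier families -/

/-- A (finite or infinite) sequence of nonempty finite sets with `G_i < G_j` for `i < j`, that is,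
every element of `G_i` is smaller than every element of `G_j`. -/
def Successive {ι : Type*} [Preorder ι] (G : ι → Finset ℕ) : Prop :=
  (∀ i, (G i).Nonempty) ∧ ∀ i j, i < j → ∀ a ∈ G i, ∀ b ∈ G j, a < b

/-- The set `{min G_1, …, min G_n}` (the sets `G_i` are nonempty wherever this is used, and
`sInf` of a nonempty set of natural numbers is its least element). -/
def mins {n : ℕ} (G : Fin n → Finset ℕ) : Finset ℕ :=
  Finset.univ.image fun i => sInf (G i : Set ℕ)

/-- `G_1 < ⋯ < G_n` is `𝓕`-admissible: `(min G_i) ∈ 𝓕`. -/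
def Admissible (𝓕 : Set (Finset ℕ)) {n : ℕ} (G : Fin n → Finset ℕ) : Prop :=
  Successive G ∧ mins G ∈ 𝓕

/-- The composition `𝓕[𝓖]`: all unions `G_1 ∪ ⋯ ∪ G_n` with `G_1 < ⋯ < G_n` in `𝓖` and
`(min G_i) ∈ 𝓕`. -/
def compFamily (𝓕 𝓖 : Set (Finset ℕ)) : Set (Finset ℕ) :=
  {F | ∃ (n : ℕ) (G : Fin n → Finset ℕ),
    Admissible 𝓕 G ∧ (∀ i, G i ∈ 𝓖) ∧ F = Finset.univ.biUnion G}

/-- `𝓢_0`: the singletons and the empty set. -/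
def schreierZero : Set (Finset ℕ) :=
  {F | F = ∅ ∨ ∃ n, F = {n}}

/-- `𝓢_1`: the empty set and the sets `F` with `|F| ≤ min F`.  The element stored as `k`
stands for the positive integer `k + 1`. -/
def schreierOne : Set (Finset ℕ) :=
  {F | ∀ k ∈ F, F.card ≤ k + 1}

/-- A choice, for each countable limit ordinal `α`, of a sequence `α_n ↑ α` of ordinals
`α_n < α`. -/
def IsLimitChoice (a : Ordinal.{0} → ℕ → Ordinal.{0}) : Prop :=
  ∀ α < ω₁, Order.IsSuccLimit α →
    Monotone (a α) ∧ (∀ n, a α n < α) ∧ IsLUB (Set.range (a α)) α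

/-- The Schreier families: `𝓢_0` as above, `𝓢_{α+1} = 𝓢_1[𝓢_α]`, and, for limit `α` with
chosen sequence `α_n ↑ α`, `𝓢_α = {F : F ∈ 𝓢_{α_n} and n ≤ F for some n}`. -/
def schreier (a : Ordinal.{0} → ℕ → Ordinal.{0}) (α : Ordinal.{0}) : Set (Finset ℕ) :=
  Ordinal.limitRecOn α schreierZero
    (fun _ S => compFamily schreierOne S)
    (fun α _ S => {F | ∃ (n : ℕ) (h : a α n < α), F ∈ S (a α n) h ∧ ∀ k ∈ F, n ≤ k})

theorem schreier_zero (a : Ordinal.{0} → ℕ → Ordinal.{0}) : schreier a 0 = schreierZero := by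
  simp [schreier]

theorem schreier_add_one (a : Ordinal.{0} → ℕ → Ordinal.{0}) (α : Ordinal.{0}) :
    schreier a (α + 1) = compFamily schreierOne (schreier a α) := by
  simp [schreier]

theorem schreier_limit (a : Ordinal.{0} → ℕ → Ordinal.{0}) (α : Ordinal.{0})
    (hα : Order.IsSuccLimit α) :
    schreier a α = {F | ∃ n, a α n < α ∧ F ∈ schreier a (a α n) ∧ ∀ k ∈ F, n ≤ k} := by
  simp [schreier, Ordinal.limitRecOn_limit _ _ _ _ hα, and_assoc]

/-! ### Block bases and the constants `δ`, `δ̇`, `δ̈` -/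

variable {X : Type*} [NormedAddCommGroup X] [NormedSpace ℝ X]

/-- The vector `∑ c_i x_i` with finitely supported coefficients `c`; its support with respect to
`(x_i)` is `c.support`. -/
def comb (x : ℕ → X) (c : ℕ →₀ ℝ) : X :=
  Finsupp.linearCombination ℝ x c

/-- `(y_i) ≺ (x_i)`: `(y_i)` is a block basis of `(x_i)`, i.e. the `y_i` are finite linear
combinations of the `x_i` with nonempty, successive supports. -/
def IsBlockBasis (x y : ℕ → X) : Prop :=
  ∃ c : ℕ → ℕ →₀ ℝ, Successive (fun i => (c i).support) ∧ ∀ i, y i = comb x (c i)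

/-- `δ_𝓕(x_i)`, computed in the norm `p`: the supremum of all `δ ≥ 0` such that
`p (∑ y_i) ≥ δ ∑ p (y_i)` for every finite block sequence `(y_i)_1^k ≺ (x_i)` that is
`𝓕`-admissible with respect to `(x_i)`. -/
def delta (𝓕 : Set (Finset ℕ)) (p : Seminorm ℝ X) (x : ℕ → X) : ℝ :=
  sSup {δ : ℝ | 0 ≤ δ ∧ ∀ (k : ℕ) (c : Fin k → ℕ →₀ ℝ),
    Admissible 𝓕 (fun i => (c i).support) →
      δ * ∑ i, p (comb x (c i)) ≤ p (∑ i, comb x (c i))}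

/-- `δ̇_𝓕(e_i)`, computed in the norm `p`: the supremum of `δ_𝓕(x_i)` over all block bases
`(x_i) ≺ (e_i)`. -/
def dotDelta (𝓕 : Set (Finset ℕ)) (p : Seminorm ℝ X) (e : ℕ → X) : ℝ :=
  sSup {d : ℝ | ∃ x : ℕ → X, IsBlockBasis e x ∧ d = delta 𝓕 p x}

/-- `p` is an equivalent norm on `X`. -/
def IsEquivalentNorm (p : Seminorm ℝ X) : Prop :=
  ∃ c C : ℝ, 0 < c ∧ ∀ x, c * ‖x‖ ≤ p x ∧ p x ≤ C * ‖x‖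

/-- `[x_i]`, the closed linear span of the sequence. -/
abbrev closedSpan (x : ℕ → X) : Submodule ℝ X :=
  (Submodule.span ℝ (Set.range x)).topologicalClosure

/-- The sequence `(x_i)` regarded as a sequence in the Banach space `[x_i]`. -/
def inClosedSpan (x : ℕ → X) (i : ℕ) : closedSpan x :=
  ⟨x i, Submodule.le_topologicalClosure _ (Submodule.subset_span (Set.mem_range_self i))⟩

/-- `δ̈_𝓕(x_i)`: the supremum of `δ̇_𝓕((x_i), |·|)` over all equivalent norms `|·|` on `[x_i]`. -/
def ddotDelta (𝓕 : Set (Finset ℕ)) (x : ℕ → X) : ℝ :=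
  sSup {d : ℝ | ∃ p : Seminorm ℝ (closedSpan x),
    IsEquivalentNorm p ∧ d = dotDelta 𝓕 p (inClosedSpan x)}

/-! ### The `Δ`-spectrum

A family `(γ_α)_{α < ω₁}` is given by a function on ordinals of which only the values at
`α < ω₁` matter. -/

/-- `(x_i)` `Δ`-stabilizes `γ`: there are `ε_n ↓ 0` such that for every `α < ω₁` there is `m` with
`|δ_α(y_i) - γ_α| < ε_n` whenever `n ≥ m` and `(y_i) ≺ (x_i)_{i ≥ n}`. -/
def DeltaStabilizes (a : Ordinal.{0} → ℕ → Ordinal.{0}) (x : ℕ → X)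
    (γ : Ordinal.{0} → ℝ) : Prop :=
  ∃ ε : ℕ → ℝ, Antitone ε ∧ Tendsto ε atTop (𝓝 0) ∧
    ∀ α < ω₁, ∃ m : ℕ, ∀ n ≥ m, ∀ y : ℕ → X, IsBlockBasis (fun i => x (n + i)) y →
      |delta (schreier a α) (normSeminorm ℝ X) y - γ α| < ε n

/-- `Δ(X)` for a space `X` with basis `(e_i)`: all `γ` that are `Δ`-stabilized by some block basis
of `(e_i)`. -/
def deltaSpectrum (a : Ordinal.{0} → ℕ → Ordinal.{0}) (e : ℕ → X) : Set (Ordinal.{0} → ℝ) :=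
  {γ | ∃ x : ℕ → X, IsBlockBasis e x ∧ DeltaStabilizes a x γ}

end AsymptoticL1

end

/-! No further block basis is needed: any `x` that stabilizes `γ` works. Write `D` for the value
`δ̈_α(x)`. The limit follows from bounds `κ d^n ≤ γ_{α·n}`, for each `0 ≤ d < D` with `κ > 0`
depending on `d`, and `γ_{α·n} ≤ A D^n` for `n ≥ 1`, with `A` depending only on a bound for the
basis projections. The constants disappear under `n`-th roots (`tendsto_rpow_one_div_of_bounds`).

The link between `α` and `α·n` is that `𝓢_{α·n}` and the `n`-fold composition of `𝓢_α` embed into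
each other along subsequences of `ℕ` (`schreier_mul_subseqLE`, `iterFamily_schreier_subseqLE`).
Since the sequences chosen at limit ordinals are arbitrary, equality cannot be expected;
subsequences are harmless because `γ` is stabilized.

Lower bound (`DeltaStabilizes.exists_mul_pow_le`): if `d < D`, some block basis satisfies, in some
equivalent norm, the `𝓢_α` lower estimate with constant `d`. Iteration gives `d^n` on the `n`-fold
composition. Returning to the original norm costs one factor `c / C`, independent of `n`.

Upper bound (`DeltaStabilizes.le_ddotDelta`): if `γ_{α·(n+1)}` exceeds `A θ^{n+1}`, a subsequence of
`x` satisfies a lower estimate for the `(n+1)`-fold composition. The renorming `∑_{j ≤ n} θ^j L_j`,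
where `L_j` is the supremum of `∑ ‖E c‖` over intervals `E` whose left ends form a set in the
`j`-fold composition, then has `𝓢_α` constant at least `θ` (`exists_renorming`). It extends to all
of `[x_i]`, so `θ ≤ D`. -/

noncomputable section

namespace AsymptoticL1

/-! ### Regular families and their compositions -/

/-- A family that contains the empty set and the singletons and is closed under passing to
subsets and under spreading. -/
structure Regular (𝓕 : Set (Finset ℕ)) : Prop where
  empty_mem : ∅ ∈ 𝓕
  singleton_mem : ∀ n, {n} ∈ 𝓕
  image_mem : ∀ F ∈ 𝓕, ∀ A ⊆ F, ∀ f : ℕ → ℕ, StrictMonoOn f A → (∀ m ∈ A, m ≤ f m) →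
    A.image f ∈ 𝓕

/-- A flexible way into the composition: blocks are indexed by points of `A`, may be empty, and may
start to the right of their index. Heredity discards the empty ones and spreading moves the indices
to the true minima. -/
theorem mem_compFamily {𝓕 𝓖 : Set (Finset ℕ)} (h𝓕 : Regular 𝓕) {A : Finset ℕ}
    (hA : A ∈ 𝓕) (H : ℕ → Finset ℕ) (hH : ∀ m ∈ A, H m ∈ 𝓖) (hle : ∀ m ∈ A, ∀ j ∈ H m, m ≤ j)
    (hlt : ∀ m ∈ A, ∀ m' ∈ A, m < m' → ∀ j ∈ H m, ∀ j' ∈ H m', j < j') :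
    A.biUnion H ∈ compFamily 𝓕 𝓖 := by
  classical
  set B := A.filter fun m => (H m).Nonempty with hB
  have hBA : ∀ m ∈ B, m ∈ A ∧ (H m).Nonempty := fun m hm => by simpa [hB] using hm
  have hinf : ∀ m ∈ B, sInf (H m : Set ℕ) ∈ H m := fun m hm => by
    have := Nat.sInf_mem (s := (H m : Set ℕ)) (by simpa using (hBA m hm).2)
    simpa using this
  refine ⟨B.card, fun i => H (B.orderEmbOfFin rfl i), ⟨⟨fun i => ?_, fun i j hij => ?_⟩, ?_⟩,
    fun i => ?_, ?_⟩
  · exact (hBA _ (B.orderEmbOfFin_mem rfl i)).2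
  · exact hlt _ (hBA _ (B.orderEmbOfFin_mem rfl i)).1 _ (hBA _ (B.orderEmbOfFin_mem rfl j)).1
      (by simpa using hij)
  · have : mins (fun i => H (B.orderEmbOfFin rfl i)) =
        B.image (fun m => sInf (H m : Set ℕ)) := by
      conv_rhs => rw [← Finset.image_orderEmbOfFin_univ B rfl]
      rw [Finset.image_image]
      rfl
    rw [this]
    refine h𝓕.image_mem A hA B (Finset.filter_subset _ _) _ ?_ ?_
    · intro m hm m' hm' hmm
      exact hlt _ (hBA _ hm).1 _ (hBA _ hm').1 hmm _ (hinf _ hm) _ (hinf _ hm')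
    · intro m hm
      exact hle _ (hBA _ hm).1 _ (hinf _ hm)
  · exact hH _ (hBA _ (B.orderEmbOfFin_mem rfl i)).1
  · ext j
    simp only [Finset.mem_biUnion, Finset.mem_univ, true_and]
    constructor
    · rintro ⟨m, hm, hj⟩
      have hmB : m ∈ B := by
        rw [hB, Finset.mem_filter]
        exact ⟨hm, j, hj⟩
      rw [← Finset.image_orderEmbOfFin_univ B rfl] at hmB
      obtain ⟨i, -, hi⟩ := Finset.mem_image.1 hmB
      exact ⟨i, hi ▸ hj⟩
    · rintro ⟨i, hi⟩
      exact ⟨_, (hBA _ (B.orderEmbOfFin_mem rfl i)).1, hi⟩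

theorem exists_of_mem_compFamily {𝓕 𝓖 : Set (Finset ℕ)} {F : Finset ℕ}
    (hF : F ∈ compFamily 𝓕 𝓖) : ∃ A ∈ 𝓕, ∃ H : ℕ → Finset ℕ, (∀ m ∈ A, H m ∈ 𝓖) ∧
      (∀ m ∈ A, m ∈ H m) ∧ (∀ m ∈ A, ∀ j ∈ H m, m ≤ j) ∧
      (∀ m ∈ A, ∀ m' ∈ A, m < m' → ∀ j ∈ H m, ∀ j' ∈ H m', j < j') ∧ F = A.biUnion H := by
  classical
  obtain ⟨n, G, ⟨⟨hne, hlt⟩, hmins⟩, hG, rfl⟩ := hF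
  have hinf : ∀ i, sInf (G i : Set ℕ) ∈ G i := fun i => by
    have := Nat.sInf_mem (s := (G i : Set ℕ)) (by simpa using hne i)
    simpa using this
  have hmono : StrictMono fun i => sInf (G i : Set ℕ) := fun i j hij =>
    hlt i j hij _ (hinf i) _ (hinf j)
  have hH : ∀ i, Function.extend (fun i => sInf (G i : Set ℕ)) G (fun _ => ∅)
      (sInf (G i : Set ℕ)) = G i := fun i => hmono.injective.extend_apply _ _ i
  refine ⟨mins G, hmins, Function.extend (fun i => sInf (G i : Set ℕ)) G (fun _ => ∅), ?_⟩
  simp only [mins, Finset.mem_image, Finset.mem_univ, true_and, forall_exists_index,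
    forall_apply_eq_imp_iff, hH]
  refine ⟨hG, hinf, fun i j hj => Nat.sInf_le hj, fun i i' h j hj j' hj' =>
    hlt i i' (hmono.lt_iff_lt.1 h) j hj j' hj', ?_⟩
  ext j
  simp [hH]

theorem subset_compFamily {𝓕 𝓖 : Set (Finset ℕ)} (h𝓕 : Regular 𝓕) : 𝓖 ⊆ compFamily 𝓕 𝓖 := by
  intro F hF
  rcases F.eq_empty_or_nonempty with rfl | hne
  · simpa using mem_compFamily (𝓖 := 𝓖) h𝓕 h𝓕.empty_mem (fun _ => ∅) (by simp) (by simp) (by simp)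
  · have := mem_compFamily (𝓖 := 𝓖) h𝓕 (h𝓕.singleton_mem (F.min' hne)) (fun _ => F)
      (by simpa) (by simpa using fun j hj => F.min'_le j hj)
      (by simpa using fun h => absurd (h _ (F.min'_mem hne)) (lt_irrefl _))
    simpa using this

theorem Regular.compFamily {𝓕 𝓖 : Set (Finset ℕ)} (h𝓕 : Regular 𝓕) (h𝓖 : Regular 𝓖) :
    Regular (compFamily 𝓕 𝓖) where
  empty_mem := subset_compFamily h𝓕 h𝓖.empty_mem
  singleton_mem n := subset_compFamily h𝓕 (h𝓖.singleton_mem n)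
  image_mem := by
    intro F hF B hB f hf hle
    obtain ⟨A, hA, H, hH, -, hAH, hlt, rfl⟩ := exists_of_mem_compFamily hF
    have : B.image f = A.biUnion fun m => (B ∩ H m).image f := by
      rw [← Finset.biUnion_image, ← Finset.inter_biUnion, Finset.inter_eq_left.2 hB]
    rw [this]
    refine mem_compFamily h𝓕 hA _ (fun m hm => ?_) (fun m hm j hj => ?_)
      (fun m hm m' hm' hmm j hj j' hj' => ?_)
    · exact h𝓖.image_mem _ (hH m hm) _ Finset.inter_subset_right f
        (hf.mono (by simp)) (fun k hk => hle k (Finset.mem_inter.1 hk).1)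
    · obtain ⟨i, hi, rfl⟩ := Finset.mem_image.1 hj
      rw [Finset.mem_inter] at hi
      exact (hAH m hm i hi.2).trans (hle i hi.1)
    · obtain ⟨i, hi, rfl⟩ := Finset.mem_image.1 hj
      obtain ⟨i', hi', rfl⟩ := Finset.mem_image.1 hj'
      rw [Finset.mem_inter] at hi hi'
      exact hf hi.1 hi'.1 (hlt m hm m' hm' hmm i hi.2 i' hi'.2)

theorem compFamily_compFamily_subset {𝓕 𝓖 𝓗 : Set (Finset ℕ)} (h𝓕 : Regular 𝓕)
    (h𝓖 : Regular 𝓖) :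
    compFamily 𝓕 (compFamily 𝓖 𝓗) ⊆ compFamily (compFamily 𝓕 𝓖) 𝓗 := by
  classical
  intro F hF
  obtain ⟨A, hA, G, hG, -, hAG, hlt, rfl⟩ := exists_of_mem_compFamily hF
  have hG' : ∀ m, ∃ B ∈ 𝓖, ∃ H : ℕ → Finset ℕ, m ∈ A → (∀ b ∈ B, H b ∈ 𝓗) ∧
      (∀ b ∈ B, b ∈ H b) ∧ (∀ b ∈ B, ∀ j ∈ H b, b ≤ j) ∧
      (∀ b ∈ B, ∀ b' ∈ B, b < b' → ∀ j ∈ H b, ∀ j' ∈ H b', j < j') ∧ G m = B.biUnion H := by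
    intro m
    by_cases hm : m ∈ A
    · obtain ⟨B, hB, H, h⟩ := exists_of_mem_compFamily (hG m hm)
      exact ⟨B, hB, H, fun _ => h⟩
    · exact ⟨∅, h𝓖.empty_mem, fun _ => ∅, fun h => (hm h).elim⟩
  choose B hB H hH using hG'
  have hBG : ∀ m ∈ A, ∀ b ∈ B m, ∀ j ∈ H m b, j ∈ G m := fun m hm b hb j hj => by
    rw [(hH m hm).2.2.2.2]
    exact Finset.mem_biUnion.2 ⟨b, hb, hj⟩
  have hBG' : ∀ m ∈ A, ∀ b ∈ B m, b ∈ G m := fun m hm b hb =>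
    hBG m hm b hb b ((hH m hm).2.1 b hb)
  have hC : A.biUnion B ∈ compFamily 𝓕 𝓖 := by
    refine mem_compFamily h𝓕 hA B (fun m _ => hB m) (fun m hm b hb => hAG m hm b (hBG' m hm b hb))
      (fun m hm m' hm' hmm j hj j' hj' => hlt m hm m' hm' hmm j (hBG' m hm j hj) j'
        (hBG' m' hm' j' hj'))
  have huniq : ∀ m ∈ A, ∀ b ∈ B m, ∀ m' ∈ A, b ∈ B m' → m' = m := by
    intro m hm b hb m' hm' hb'
    rcases lt_trichotomy m m' with h | h | h
    · exact (lt_irrefl _ (hlt m hm m' hm' h b (hBG' m hm b hb) b (hBG' m' hm' b hb'))).elim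
    · exact h.symm
    · exact (lt_irrefl _ (hlt m' hm' m hm h b (hBG' m' hm' b hb') b (hBG' m hm b hb))).elim
  -- The sets `B m` are pairwise disjoint, so `b` determines `m` and the inner blocks glue to one
  -- function of `b`.
  let K : ℕ → Finset ℕ := fun b => if h : ∃ m ∈ A, b ∈ B m then H h.choose b else ∅
  have hK : ∀ m ∈ A, ∀ b ∈ B m, K b = H m b := by
    intro m hm b hb
    have h : ∃ m ∈ A, b ∈ B m := ⟨m, hm, hb⟩
    have : h.choose = m := huniq m hm b hb _ h.choose_spec.1 h.choose_spec.2
    simp only [K, dif_pos h, this]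
  have hF : A.biUnion G = (A.biUnion B).biUnion K := by
    rw [Finset.biUnion_biUnion]
    refine Finset.biUnion_congr rfl fun m hm => ?_
    rw [(hH m hm).2.2.2.2]
    exact Finset.biUnion_congr rfl fun b hb => (hK m hm b hb).symm
  rw [hF]
  refine mem_compFamily (h𝓕.compFamily h𝓖) hC K ?_ ?_ ?_
  · intro b hb
    obtain ⟨m, hm, hb⟩ := Finset.mem_biUnion.1 hb
    rw [hK m hm b hb]
    exact (hH m hm).1 b hb
  · intro b hb
    obtain ⟨m, hm, hb⟩ := Finset.mem_biUnion.1 hb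
    rw [hK m hm b hb]
    exact (hH m hm).2.2.1 b hb
  · intro b hb b' hb' hbb
    obtain ⟨m, hm, hb⟩ := Finset.mem_biUnion.1 hb
    obtain ⟨m', hm', hb'⟩ := Finset.mem_biUnion.1 hb'
    rw [hK m hm b hb, hK m' hm' b' hb']
    rcases lt_trichotomy m m' with h | rfl | h
    · exact fun j hj j' hj' => hlt m hm m' hm' h j (hBG m hm b hb j hj) j'
        (hBG m' hm' b' hb' j' hj')
    · exact (hH m hm).2.2.2.1 b hb b' hb' hbb
    · exact (lt_asymm hbb (hlt m' hm' m hm h b' (hBG' m' hm' b' hb') b (hBG' m hm b hb))).elim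

theorem compFamily_compFamily_superset {𝓕 𝓖 𝓗 : Set (Finset ℕ)} (h𝓕 : Regular 𝓕)
    (h𝓖 : Regular 𝓖) :
    compFamily (compFamily 𝓕 𝓖) 𝓗 ⊆ compFamily 𝓕 (compFamily 𝓖 𝓗) := by
  classical
  intro F hF
  obtain ⟨C, hC, K, hK, -, hCK, hltK, rfl⟩ := exists_of_mem_compFamily hF
  obtain ⟨A, hA, B, hB, -, hAB, hltB, rfl⟩ := exists_of_mem_compFamily hC
  have hmem : ∀ m ∈ A, ∀ b ∈ B m, b ∈ A.biUnion B := fun m hm b hb =>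
    Finset.mem_biUnion.2 ⟨m, hm, hb⟩
  rw [Finset.biUnion_biUnion]
  refine mem_compFamily h𝓕 hA _ (fun m hm => ?_) ?_ ?_
  · exact mem_compFamily h𝓖 (hB m hm) K (fun b hb => hK b (hmem m hm b hb))
      (fun b hb => hCK b (hmem m hm b hb))
      (fun b hb b' hb' => hltK b (hmem m hm b hb) b' (hmem m hm b' hb'))
  · intro m hm j hj
    obtain ⟨b, hb, hj⟩ := Finset.mem_biUnion.1 hj
    exact (hAB m hm b hb).trans (hCK b (hmem m hm b hb) j hj)
  · intro m hm m' hm' hmm j hj j' hj'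
    obtain ⟨b, hb, hj⟩ := Finset.mem_biUnion.1 hj
    obtain ⟨b', hb', hj'⟩ := Finset.mem_biUnion.1 hj'
    exact hltK b (hmem m hm b hb) b' (hmem m' hm' b' hb') (hltB m hm m' hm' hmm b hb b' hb')
      j hj j' hj'

/-! ### Inclusion of families along a subsequence -/

/-- Some subsequence of `ℕ` maps the sets of `𝓕` to sets of `𝓖`. -/
def SubseqLE (𝓕 𝓖 : Set (Finset ℕ)) : Prop :=
  ∃ M : ℕ → ℕ, StrictMono M ∧ ∀ F ∈ 𝓕, F.image M ∈ 𝓖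

theorem SubseqLE.of_subset {𝓕 𝓖 : Set (Finset ℕ)} (h : 𝓕 ⊆ 𝓖) : SubseqLE 𝓕 𝓖 :=
  ⟨id, strictMono_id, fun F hF => by simpa using h hF⟩

theorem SubseqLE.trans {𝓕 𝓖 𝓗 : Set (Finset ℕ)} (h₁ : SubseqLE 𝓕 𝓖) (h₂ : SubseqLE 𝓖 𝓗) :
    SubseqLE 𝓕 𝓗 := by
  obtain ⟨M, hM, h⟩ := h₁
  obtain ⟨M', hM', h'⟩ := h₂
  exact ⟨M' ∘ M, hM'.comp hM, fun F hF => by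
    rw [← Finset.image_image]
    exact h' _ (h F hF)⟩

theorem SubseqLE.of_tail_subset {𝓕 𝓖 : Set (Finset ℕ)} (h𝓕 : Regular 𝓕) {j : ℕ}
    (h : ∀ F ∈ 𝓕, (∀ k ∈ F, j ≤ k) → F ∈ 𝓖) : SubseqLE 𝓕 𝓖 := by
  have hmono : StrictMono fun i => i + j := fun _ _ h => by simpa using h
  refine ⟨fun i => i + j, hmono, fun F hF => h _ ?_ ?_⟩
  · exact h𝓕.image_mem F hF F subset_rfl _ (hmono.strictMonoOn _) (by simp)
  · simp

theorem SubseqLE.compFamily {𝓕 𝓖 𝓖' : Set (Finset ℕ)} (h𝓕 : Regular 𝓕) (h : SubseqLE 𝓖 𝓖') :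
    SubseqLE (compFamily 𝓕 𝓖) (compFamily 𝓕 𝓖') := by
  obtain ⟨M, hM, h⟩ := h
  refine ⟨M, hM, fun F hF => ?_⟩
  obtain ⟨A, hA, H, hH, -, hAH, hlt, rfl⟩ := exists_of_mem_compFamily hF
  rw [Finset.biUnion_image]
  refine mem_compFamily h𝓕 hA _ (fun m hm => h _ (hH m hm)) ?_ ?_
  · intro m hm j hj
    obtain ⟨i, hi, rfl⟩ := Finset.mem_image.1 hj
    exact (hAH m hm i hi).trans (hM.le_apply)
  · intro m hm m' hm' hmm j hj j' hj'
    obtain ⟨i, hi, rfl⟩ := Finset.mem_image.1 hj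
    obtain ⟨i', hi', rfl⟩ := Finset.mem_image.1 hj'
    exact hM (hlt m hm m' hm' hmm i hi i' hi')

theorem exists_strictMono_ge (f : ℕ → ℕ → ℕ) :
    ∃ M : ℕ → ℕ, StrictMono M ∧ ∀ n i, n ≤ i → f n i ≤ M i := by
  refine ⟨fun i => ∑ k ∈ Finset.range (i + 1), (∑ n ∈ Finset.range (k + 1), f n k + 1),
    strictMono_nat_of_lt_succ fun i => ?_, fun n i hni => ?_⟩
  · rw [Finset.sum_range_succ _ (i + 1)]
    omega
  · calc f n i ≤ ∑ n ∈ Finset.range (i + 1), f n i :=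
          Finset.single_le_sum (f := fun n => f n i) (fun _ _ => Nat.zero_le _)
            (Finset.mem_range.2 (by omega))
      _ ≤ ∑ n ∈ Finset.range (i + 1), f n i + 1 := Nat.le_succ _
      _ ≤ _ := Finset.single_le_sum
          (f := fun k => ∑ n ∈ Finset.range (k + 1), f n k + 1) (fun _ _ => Nat.zero_le _)
          (Finset.mem_range.2 (Nat.lt_succ_self i))

/-- Diagonalization for limit ordinals: one `M` with `M i ≥ M' n i + j n` for all `n ≤ i` serves all
`n` at once, because a set in `𝓕' n` only has to be handled from `n` on. -/
theorem SubseqLE.of_diagonal {𝓕 𝓖 : Set (Finset ℕ)} (𝓕' 𝓖' : ℕ → Set (Finset ℕ)) (j : ℕ → ℕ)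
    (h𝓕 : ∀ F ∈ 𝓕, ∃ n, F ∈ 𝓕' n ∧ ∀ k ∈ F, n ≤ k) (hsub : ∀ n, SubseqLE (𝓕' n) (𝓖' n))
    (hreg : ∀ n, Regular (𝓖' n)) (h𝓖 : ∀ n, ∀ F ∈ 𝓖' n, (∀ k ∈ F, j n ≤ k) → F ∈ 𝓖) :
    SubseqLE 𝓕 𝓖 := by
  choose M' hM' h using hsub
  obtain ⟨M, hM, hle⟩ := exists_strictMono_ge fun n i => M' n i + j n
  refine ⟨M, hM, fun F hF => ?_⟩
  obtain ⟨n, hFn, hn⟩ := h𝓕 F hF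
  refine h𝓖 n _ ?_ ?_
  · have hmono := (hM' n)
    -- The map `M' n i ↦ M i` moves points to the right for `i ∈ F`, so `F.image M` is a spread of
    -- `F.image (M' n)`.
    let f : ℕ → ℕ := fun k => M (Function.invFun (M' n) k)
    have hf : ∀ i, f (M' n i) = M i := fun i => by
      simp only [f, Function.leftInverse_invFun hmono.injective i]
    have : F.image M = (F.image (M' n)).image f := by
      rw [Finset.image_image]
      exact Finset.image_congr fun i _ => (hf i).symm
    rw [this]
    refine (hreg n).image_mem _ (h n F hFn) _ subset_rfl f ?_ ?_
    · intro k hk k' hk' hkk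
      simp only [Finset.coe_image, Set.mem_image] at hk hk'
      obtain ⟨i, -, rfl⟩ := hk
      obtain ⟨i', -, rfl⟩ := hk'
      rw [hf, hf]
      exact hM (hmono.lt_iff_lt.1 hkk)
    · intro k hk
      obtain ⟨i, hi, rfl⟩ := Finset.mem_image.1 hk
      rw [hf]
      exact (Nat.le_add_right _ _).trans (hle n i (hn i hi))
  · intro k hk
    obtain ⟨i, hi, rfl⟩ := Finset.mem_image.1 hk
    exact (Nat.le_add_left _ _).trans (hle n i (hn i hi))

/-! ### The Schreier families -/

theorem regular_schreierZero : Regular schreierZero where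
  empty_mem := Or.inl rfl
  singleton_mem n := Or.inr ⟨n, rfl⟩
  image_mem := by
    rintro F hF A hA f - -
    rcases hF with rfl | ⟨n, rfl⟩
    · left
      simp [Finset.subset_empty.1 hA]
    · rcases Finset.subset_singleton_iff.1 hA with rfl | rfl
      · left; simp
      · right; exact ⟨f n, by simp⟩

theorem regular_schreierOne : Regular schreierOne where
  empty_mem := by simp [schreierOne]
  singleton_mem n := by simp [schreierOne]
  image_mem := by
    intro F hF A hA f _ hle k hk
    obtain ⟨i, hi, rfl⟩ := Finset.mem_image.1 hk
    calc (A.image f).card ≤ A.card := Finset.card_image_le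
      _ ≤ F.card := Finset.card_le_card hA
      _ ≤ i + 1 := hF i (hA hi)
      _ ≤ f i + 1 := Nat.succ_le_succ (hle i hi)

section Schreier

variable {a : Ordinal.{0} → ℕ → Ordinal.{0}}

theorem regular_schreier (ha : IsLimitChoice a) (α : Ordinal.{0}) (hα : α < ω₁) :
    Regular (schreier a α) := by
  induction α using Ordinal.limitRecOn with
  | zero => rw [schreier_zero]; exact regular_schreierZero
  | add_one α ih =>
    rw [schreier_add_one]
    exact regular_schreierOne.compFamily (ih ((lt_add_one α).trans hα))
  | limit α hlim ih =>
    have hlt := (ha α hα hlim).2.1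
    have ih' : ∀ n, Regular (schreier a (a α n)) := fun n =>
      ih _ (hlt n) ((hlt n).trans hα)
    rw [schreier_limit a α hlim]
    refine ⟨⟨0, hlt 0, (ih' 0).empty_mem, by simp⟩,
      fun n => ⟨0, hlt 0, (ih' 0).singleton_mem n, by simp⟩, ?_⟩
    rintro F ⟨n, hn, hF, hle⟩ A hA f hf hfle
    refine ⟨n, hn, (ih' n).image_mem F hF A hA f hf hfle, fun k hk => ?_⟩
    obtain ⟨i, hi, rfl⟩ := Finset.mem_image.1 hk
    exact (hle i (hA hi)).trans (hfle i hi)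

theorem IsLimitChoice.exists_lt (ha : IsLimitChoice a) {α β : Ordinal.{0}} (hα : α < ω₁)
    (hlim : Order.IsSuccLimit α) (hβ : β < α) : ∃ n, β < a α n := by
  obtain ⟨_, ⟨n, rfl⟩, hn⟩ := (lt_isLUB_iff (ha α hα hlim).2.2).1 hβ
  exact ⟨n, hn⟩

/-- The Schreier families increase with the ordinal only up to finitely many initial points:
entering the family of a limit ordinal at its `n`-th term requires sets beyond `n`. -/
theorem exists_schreier_tail_subset (ha : IsLimitChoice a) {α β : Ordinal.{0}} (hβ : β < ω₁)
    (hαβ : α ≤ β) : ∃ j, ∀ F ∈ schreier a α, (∀ k ∈ F, j ≤ k) → F ∈ schreier a β := by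
  induction β using Ordinal.limitRecOn with
  | zero =>
    obtain rfl : α = 0 := by simpa using hαβ
    exact ⟨0, fun F hF _ => hF⟩
  | add_one β ih =>
    rcases hαβ.eq_or_lt with rfl | h
    · exact ⟨0, fun F hF _ => hF⟩
    · obtain ⟨j, hj⟩ := ih ((lt_add_one β).trans hβ) (Order.lt_add_one_iff.1 h)
      refine ⟨j, fun F hF hk => ?_⟩
      rw [schreier_add_one]
      exact subset_compFamily regular_schreierOne (hj F hF hk)
  | limit β hlim ih =>
    rcases hαβ.eq_or_lt with rfl | h
    · exact ⟨0, fun F hF _ => hF⟩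
    · obtain ⟨n, hn⟩ := ha.exists_lt hβ hlim h
      have hnβ := (ha β hβ hlim).2.1 n
      obtain ⟨j, hj⟩ := ih _ hnβ (hnβ.trans hβ) hn.le
      refine ⟨max j n, fun F hF hk => ?_⟩
      rw [schreier_limit a β hlim]
      exact ⟨n, hnβ, hj F hF fun k hkF => (le_max_left _ _).trans (hk k hkF),
        fun k hkF => (le_max_right _ _).trans (hk k hkF)⟩

/-! ### Ordinal sums and composition of Schreier families. -/

theorem add_lt_omega_one {α β : Ordinal.{0}} (hα : α < ω₁) (hβ : β < ω₁) : α + β < ω₁ :=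
  Ordinal.isPrincipal_add_omega 1 hα hβ

theorem mul_natCast_lt_omega_one {α : Ordinal.{0}} (hα : α < ω₁) (n : ℕ) :
    α * (n : Ordinal.{0}) < ω₁ := by
  induction n with
  | zero => simpa using Ordinal.omega_pos 1
  | succ n ih =>
    rw [Nat.cast_succ, mul_add_one]
    exact add_lt_omega_one ih hα

theorem subset_schreierZero_compFamily (𝓖 : Set (Finset ℕ)) : 𝓖 ⊆ compFamily schreierZero 𝓖 :=
  subset_compFamily regular_schreierZero

theorem schreierZero_compFamily_subset {𝓖 : Set (Finset ℕ)} (h𝓖 : Regular 𝓖) :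
    compFamily schreierZero 𝓖 ⊆ 𝓖 := by
  intro F hF
  obtain ⟨A, hA, H, hH, -, -, -, rfl⟩ := exists_of_mem_compFamily hF
  rcases hA with rfl | ⟨n, rfl⟩
  · simpa using h𝓖.empty_mem
  · simpa using hH

theorem schreier_add_subseqLE (ha : IsLimitChoice a) {β : Ordinal.{0}} (hβ : β < ω₁)
    (α : Ordinal.{0}) (hα : α < ω₁) :
    SubseqLE (schreier a (β + α)) (compFamily (schreier a α) (schreier a β)) := by
  induction α using Ordinal.limitRecOn with
  | zero =>
    rw [add_zero, schreier_zero]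
    exact .of_subset (subset_schreierZero_compFamily _)
  | add_one α ih =>
    have hα' := (lt_add_one α).trans hα
    rw [← add_assoc, schreier_add_one, schreier_add_one]
    exact (SubseqLE.compFamily regular_schreierOne (ih hα')).trans
      (.of_subset (compFamily_compFamily_subset regular_schreierOne (regular_schreier ha α hα')))
  | limit α hlim ih =>
    have hρ := add_lt_omega_one hβ hα
    have hρlim := Ordinal.isSuccLimit_add β hlim
    have hρlt := (ha _ hρ hρlim).2.1
    -- The sequence chosen for `β + α` is unrelated to the one chosen for `α`, but each of its terms
    -- is overtaken by some `β + a α k`.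
    have key : ∀ n, ∃ k, a (β + α) n ≤ β + a α k := by
      intro n
      obtain ⟨d, hd, hlt⟩ := (Ordinal.lt_add_iff_of_isSuccLimit hlim).1 (hρlt n)
      obtain ⟨k, hk⟩ := ha.exists_lt hα hlim hd
      exact ⟨k, hlt.le.trans (by gcongr)⟩
    choose k hk using key
    have hαk : ∀ n, a α (k n) < α := fun n => (ha α hα hlim).2.1 (k n)
    refine .of_diagonal (fun n => schreier a (a (β + α) n))
      (fun n => compFamily (schreier a (a α (k n))) (schreier a β)) k ?_ ?_ ?_ ?_
    · intro F hF
      rw [schreier_limit a _ hρlim] at hF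
      obtain ⟨n, -, hF, hn⟩ := hF
      exact ⟨n, hF, hn⟩
    · intro n
      obtain ⟨j, hj⟩ := exists_schreier_tail_subset ha
        (add_lt_omega_one hβ ((hαk n).trans hα)) (hk n)
      exact (SubseqLE.of_tail_subset (regular_schreier ha _ ((hρlt n).trans hρ)) hj).trans
        (ih _ (hαk n) ((hαk n).trans hα))
    · exact fun n => (regular_schreier ha _ ((hαk n).trans hα)).compFamily
        (regular_schreier ha β hβ)
    · intro n F hF hle
      obtain ⟨A, hA, H, hH, hmem, hAH, hlt, rfl⟩ := exists_of_mem_compFamily hF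
      refine mem_compFamily (regular_schreier ha α hα) ?_ H hH hAH hlt
      rw [schreier_limit a α hlim]
      exact ⟨k n, hαk n, hA, fun m hm => hle m (Finset.mem_biUnion.2 ⟨m, hm, hmem m hm⟩)⟩

theorem compFamily_schreier_subseqLE (ha : IsLimitChoice a) {β : Ordinal.{0}} (hβ : β < ω₁)
    (α : Ordinal.{0}) (hα : α < ω₁) :
    SubseqLE (compFamily (schreier a α) (schreier a β)) (schreier a (β + α)) := by
  induction α using Ordinal.limitRecOn with
  | zero =>
    rw [add_zero, schreier_zero]
    exact .of_subset (schreierZero_compFamily_subset (regular_schreier ha β hβ))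
  | add_one α ih =>
    have hα' := (lt_add_one α).trans hα
    rw [← add_assoc, schreier_add_one, schreier_add_one]
    exact (SubseqLE.of_subset (compFamily_compFamily_superset regular_schreierOne
      (regular_schreier ha α hα'))).trans (SubseqLE.compFamily regular_schreierOne (ih hα'))
  | limit α hlim ih =>
    have hρ := add_lt_omega_one hβ hα
    have hρlim := Ordinal.isSuccLimit_add β hlim
    have hρlt := (ha _ hρ hρlim).2.1
    have hαn : ∀ n, a α n < α := (ha α hα hlim).2.1
    have key : ∀ n, ∃ j, ∀ F ∈ schreier a (β + a α n), (∀ k ∈ F, j ≤ k) →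
        F ∈ schreier a (β + α) := fun n =>
      exists_schreier_tail_subset ha hρ (by gcongr; exact (hαn n).le)
    choose j hj using key
    refine .of_diagonal (fun n => compFamily (schreier a (a α n)) (schreier a β))
      (fun n => schreier a (β + a α n)) j ?_ ?_ ?_ hj
    · intro F hF
      obtain ⟨A, hA, H, hH, hmem, hAH, hlt, rfl⟩ := exists_of_mem_compFamily hF
      rw [schreier_limit a α hlim] at hA
      obtain ⟨n, -, hA, hn⟩ := hA
      refine ⟨n, mem_compFamily (regular_schreier ha _ ((hαn n).trans hα)) hA H hH hAH hlt, ?_⟩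
      intro i hi
      obtain ⟨m, hm, hi⟩ := Finset.mem_biUnion.1 hi
      exact (hn m hm).trans (hAH m hm i hi)
    · exact fun n => ih _ (hαn n) ((hαn n).trans hα)
    · exact fun n => regular_schreier ha _ (add_lt_omega_one hβ ((hαn n).trans hα))

end Schreier

/-- The `n`-fold composition `𝓕[𝓕[⋯[𝓢_0]]]`. -/
def iterFamily (𝓕 : Set (Finset ℕ)) : ℕ → Set (Finset ℕ)
  | 0 => schreierZero
  | n + 1 => compFamily 𝓕 (iterFamily 𝓕 n)

theorem Regular.iterFamily {𝓕 : Set (Finset ℕ)} (h𝓕 : Regular 𝓕) (n : ℕ) :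
    Regular (iterFamily 𝓕 n) := by
  induction n with
  | zero => exact regular_schreierZero
  | succ n ih => exact h𝓕.compFamily ih

theorem iterFamily_mono {𝓕 : Set (Finset ℕ)} (h𝓕 : Regular 𝓕) : Monotone (iterFamily 𝓕) :=
  monotone_nat_of_le_succ fun _ => subset_compFamily h𝓕

theorem schreier_mul_subseqLE {a : Ordinal.{0} → ℕ → Ordinal.{0}} (ha : IsLimitChoice a)
    {α : Ordinal.{0}} (hα : α < ω₁) (n : ℕ) :
    SubseqLE (schreier a (α * (n : Ordinal.{0}))) (iterFamily (schreier a α) n) := by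
  induction n with
  | zero => simpa [schreier_zero, iterFamily] using SubseqLE.of_subset (subset_refl schreierZero)
  | succ n ih =>
    rw [Nat.cast_succ, mul_add_one]
    exact (schreier_add_subseqLE ha (mul_natCast_lt_omega_one hα n) α hα).trans
      (SubseqLE.compFamily (regular_schreier ha α hα) ih)

theorem iterFamily_schreier_subseqLE {a : Ordinal.{0} → ℕ → Ordinal.{0}} (ha : IsLimitChoice a)
    {α : Ordinal.{0}} (hα : α < ω₁) (n : ℕ) :
    SubseqLE (iterFamily (schreier a α) n) (schreier a (α * (n : Ordinal.{0}))) := by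
  induction n with
  | zero => simpa [schreier_zero, iterFamily] using SubseqLE.of_subset (subset_refl schreierZero)
  | succ n ih =>
    rw [Nat.cast_succ, mul_add_one]
    exact (SubseqLE.compFamily (regular_schreier ha α hα) ih).trans
      (compFamily_schreier_subseqLE ha (mul_natCast_lt_omega_one hα n) α hα)

/-! ### Lower `ℓ₁` estimates for seminorms on the finitely supported sequences -/

/-- The lower estimate `δ ∑ P (d_m) ≤ P (∑ d_m)` whenever `F ∈ 𝓕` and, for each `m ∈ F`, the
(possibly zero) vector `d_m` is supported between `m` and the successor of `m` in `F`. -/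
def LowerEstimate (𝓕 : Set (Finset ℕ)) (P : Seminorm ℝ (ℕ →₀ ℝ)) (δ : ℝ) : Prop :=
  ∀ F ∈ 𝓕, ∀ d : ℕ → ℕ →₀ ℝ, (∀ m ∈ F, ∀ j ∈ (d m).support, m ≤ j) →
    (∀ m ∈ F, ∀ m' ∈ F, m < m' → ∀ j ∈ (d m).support, j < m') →
    δ * ∑ m ∈ F, P (d m) ≤ P (∑ m ∈ F, d m)

theorem sum_orderEmbOfFin {M : Type*} [AddCommMonoid M] (B : Finset ℕ) (g : ℕ → M) :
    ∑ i, g (B.orderEmbOfFin rfl i) = ∑ m ∈ B, g m := by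
  conv_rhs => rw [← Finset.image_orderEmbOfFin_univ B rfl]
  rw [Finset.sum_image fun i _ j _ h => (B.orderEmbOfFin rfl).injective h]

/-- Zero vectors contribute nothing and can be dropped; the minima of the remaining supports are a
spread of a subset of `F`. -/
theorem lowerEstimate_iff {𝓕 : Set (Finset ℕ)} (h𝓕 : Regular 𝓕) {P : Seminorm ℝ (ℕ →₀ ℝ)}
    {δ : ℝ} : LowerEstimate 𝓕 P δ ↔ ∀ (k : ℕ) (c : Fin k → ℕ →₀ ℝ),
      Admissible 𝓕 (fun i => (c i).support) → δ * ∑ i, P (c i) ≤ P (∑ i, c i) := by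
  classical
  constructor
  · rintro h k c ⟨⟨hne, hlt⟩, hmins⟩
    have hinf : ∀ i, sInf ((c i).support : Set ℕ) ∈ (c i).support := fun i => by
      have := Nat.sInf_mem (s := ((c i).support : Set ℕ)) (by simpa using hne i)
      exact_mod_cast this
    have hmono : StrictMono fun i => sInf ((c i).support : Set ℕ) := fun i j hij =>
      hlt i j hij _ (hinf i) _ (hinf j)
    have hH : ∀ i, Function.extend (fun i => sInf ((c i).support : Set ℕ)) c (fun _ => 0)
        (sInf ((c i).support : Set ℕ)) = c i := fun i => hmono.injective.extend_apply _ _ i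
    have := h _ hmins (Function.extend (fun i => sInf ((c i).support : Set ℕ)) c (fun _ => 0))
      ?_ ?_
    · unfold mins at this
      rw [Finset.sum_image fun i _ j _ h => hmono.injective h,
        Finset.sum_image fun i _ j _ h => hmono.injective h] at this
      simpa only [hH] using this
    · simp only [mins, Finset.mem_image, Finset.mem_univ, true_and, forall_exists_index,
        forall_apply_eq_imp_iff, hH]
      exact fun i j hj => Nat.sInf_le hj
    · simp only [mins, Finset.mem_image, Finset.mem_univ, true_and, forall_exists_index,
        forall_apply_eq_imp_iff, hH]
      exact fun i i' h j hj => hlt i i' (hmono.lt_iff_lt.1 h) j hj _ (hinf i')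
  · intro h F hF d hle hlt
    set B := F.filter fun m => d m ≠ 0 with hB
    have hBF : ∀ m ∈ B, m ∈ F ∧ d m ≠ 0 := fun m hm => by simpa [hB] using hm
    have hinf : ∀ m ∈ B, sInf ((d m).support : Set ℕ) ∈ (d m).support := fun m hm => by
      have := Nat.sInf_mem (s := ((d m).support : Set ℕ))
        (by simpa using (hBF m hm).2)
      exact_mod_cast this
    have hmemB := B.orderEmbOfFin_mem rfl
    have := h B.card (fun i => d (B.orderEmbOfFin rfl i)) ⟨⟨fun i => ?_, fun i j hij => ?_⟩, ?_⟩
    · rw [sum_orderEmbOfFin B fun m => P (d m), sum_orderEmbOfFin B fun m => d m, hB,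
        Finset.sum_filter_ne_zero, Finset.sum_filter_of_ne] at this
      · exact this
      · intro m _ hm h0
        exact hm (by rw [h0, map_zero])
    · exact Finsupp.support_nonempty_iff.2 (hBF _ (hmemB i)).2
    · intro k hk k' hk'
      exact (hlt _ (hBF _ (hmemB i)).1 _ (hBF _ (hmemB j)).1 (by simpa using hij) k hk).trans_le
        (hle _ (hBF _ (hmemB j)).1 k' hk')
    · have : mins (fun i => (d (B.orderEmbOfFin rfl i)).support) =
          B.image (fun m => sInf ((d m).support : Set ℕ)) := by
        conv_rhs => rw [← Finset.image_orderEmbOfFin_univ B rfl]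
        rw [Finset.image_image]
        rfl
      rw [this]
      refine h𝓕.image_mem F hF B (Finset.filter_subset _ _) _ ?_ ?_
      · intro m hm m' hm' hmm
        exact (hlt _ (hBF _ hm).1 _ (hBF _ hm').1 hmm _ (hinf _ hm)).trans_le
          (hle _ (hBF _ hm').1 _ (hinf _ hm'))
      · intro m hm
        exact hle _ (hBF _ hm).1 _ (hinf _ hm)

theorem LowerEstimate.mono_family {𝓕 𝓖 : Set (Finset ℕ)} {P : Seminorm ℝ (ℕ →₀ ℝ)} {δ : ℝ}
    (h : LowerEstimate 𝓖 P δ) (h𝓕 : 𝓕 ⊆ 𝓖) : LowerEstimate 𝓕 P δ :=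
  fun F hF => h F (h𝓕 hF)

theorem LowerEstimate.mono {𝓕 : Set (Finset ℕ)} {P : Seminorm ℝ (ℕ →₀ ℝ)} {δ δ' : ℝ}
    (h : LowerEstimate 𝓕 P δ) (hδ : δ' ≤ δ) : LowerEstimate 𝓕 P δ' :=
  fun F hF d h₁ h₂ => (mul_le_mul_of_nonneg_right hδ
    (Finset.sum_nonneg fun _ _ => apply_nonneg P _)).trans (h F hF d h₁ h₂)

theorem lowerEstimate_schreierZero (P : Seminorm ℝ (ℕ →₀ ℝ)) :
    LowerEstimate schreierZero P 1 := by
  rintro F (rfl | ⟨n, rfl⟩) d - - <;> simp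

/-- Apply the outer estimate to the sums over the blocks `H m`, then the inner estimate within each
block: the constants multiply. -/
theorem LowerEstimate.compFamily {𝓕 𝓖 : Set (Finset ℕ)} {P : Seminorm ℝ (ℕ →₀ ℝ)} {δ δ' : ℝ}
    (hδ : 0 ≤ δ) (h𝓕 : LowerEstimate 𝓕 P δ) (h𝓖 : LowerEstimate 𝓖 P δ') :
    LowerEstimate (compFamily 𝓕 𝓖) P (δ * δ') := by
  classical
  intro F hF d hle hlt
  obtain ⟨A, hA, H, hH, hmem, hAH, hltH, rfl⟩ := exists_of_mem_compFamily hF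
  have hsub : ∀ m ∈ A, ∀ i ∈ H m, i ∈ A.biUnion H := fun m hm i hi =>
    Finset.mem_biUnion.2 ⟨m, hm, hi⟩
  have hdisj : (A : Set ℕ).PairwiseDisjoint H := by
    intro m hm m' hm' hne
    refine Finset.disjoint_left.2 fun i hi hi' => ?_
    rcases hne.lt_or_gt with h | h
    · exact lt_irrefl _ (hltH m hm m' hm' h i hi i hi')
    · exact lt_irrefl _ (hltH m' hm' m hm h i hi' i hi)
  rw [Finset.sum_biUnion hdisj, Finset.sum_biUnion hdisj]
  have h₁ := h𝓕 A hA (fun m => ∑ i ∈ H m, d i) ?_ ?_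
  · refine le_trans ?_ h₁
    rw [mul_assoc, Finset.mul_sum]
    gcongr with m hm
    exact h𝓖 (H m) (hH m hm) d (fun i hi => hle i (hsub m hm i hi))
      (fun i hi i' hi' => hlt i (hsub m hm i hi) i' (hsub m hm i' hi'))
  · intro m hm j hj
    obtain ⟨i, hi, hj⟩ := Finset.mem_biUnion.1 (Finsupp.support_finsetSum hj)
    exact (hAH m hm i hi).trans (hle i (hsub m hm i hi) j hj)
  · intro m hm m' hm' hmm j hj
    obtain ⟨i, hi, hj⟩ := Finset.mem_biUnion.1 (Finsupp.support_finsetSum hj)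
    exact hlt i (hsub m hm i hi) m' (hsub m' hm' m' (hmem m' hm'))
      (hltH m hm m' hm' hmm i hi m' (hmem m' hm')) j hj

theorem LowerEstimate.iterFamily {𝓕 : Set (Finset ℕ)} {P : Seminorm ℝ (ℕ →₀ ℝ)} {δ : ℝ}
    (hδ : 0 ≤ δ) (h : LowerEstimate 𝓕 P δ) (n : ℕ) :
    LowerEstimate (iterFamily 𝓕 n) P (δ ^ n) := by
  induction n with
  | zero => simpa [AsymptoticL1.iterFamily] using lowerEstimate_schreierZero P
  | succ n ih => rw [pow_succ']; exact h.compFamily hδ ih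

theorem LowerEstimate.comp_lmapDomain {𝓕 𝓖 : Set (Finset ℕ)} {P : Seminorm ℝ (ℕ →₀ ℝ)} {δ : ℝ}
    (h : LowerEstimate 𝓖 P δ) {M : ℕ → ℕ} (hM : StrictMono M) (h𝓕 : ∀ F ∈ 𝓕, F.image M ∈ 𝓖) :
    LowerEstimate 𝓕 (P.comp (Finsupp.lmapDomain ℝ ℝ M)) δ := by
  classical
  intro F hF d hle hlt
  have hsupp : ∀ m, ∀ j ∈ (Finsupp.mapDomain M (d m)).support, ∃ i ∈ (d m).support, M i = j :=
    fun m j hj => Finset.mem_image.1 (Finsupp.mapDomain_support hj)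
  have hinv := Function.leftInverse_invFun hM.injective
  have := h _ (h𝓕 F hF) (fun m => Finsupp.mapDomain M (d (Function.invFun M m))) ?_ ?_
  · rw [Finset.sum_image fun i _ j _ h => hM.injective h,
      Finset.sum_image fun i _ j _ h => hM.injective h] at this
    simp only [hinv _] at this
    simpa only [Seminorm.comp_apply, Finsupp.lmapDomain_apply, map_sum] using this
  · simp only [Finset.forall_mem_image, hinv _]
    intro m hm j hj
    obtain ⟨i, hi, rfl⟩ := hsupp m j hj
    exact hM.monotone (hle m hm i hi)
  · simp only [Finset.forall_mem_image, hinv _]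
    intro m hm m' hm' hmm j hj
    obtain ⟨i, hi, rfl⟩ := hsupp m j hj
    exact hM (hlt m hm m' hm' (hM.lt_iff_lt.1 hmm) i hi)

theorem LowerEstimate.of_equivalent {𝓕 : Set (Finset ℕ)} {P Q : Seminorm ℝ (ℕ →₀ ℝ)} {δ c C : ℝ}
    (hδ : 0 ≤ δ) (hC : 0 < C) (h : LowerEstimate 𝓕 P δ)
    (hPQ : ∀ x, c * Q x ≤ P x ∧ P x ≤ C * Q x) : LowerEstimate 𝓕 Q (c / C * δ) := by
  intro F hF d hle hlt
  have h₁ : c * ∑ m ∈ F, Q (d m) ≤ ∑ m ∈ F, P (d m) := by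
    rw [Finset.mul_sum]
    exact Finset.sum_le_sum fun m _ => (hPQ _).1
  have h₂ := (h F hF d hle hlt).trans (hPQ _).2
  have h₃ := mul_le_mul_of_nonneg_left h₁ hδ
  calc c / C * δ * ∑ m ∈ F, Q (d m) = δ * (c * ∑ m ∈ F, Q (d m)) / C := by ring
    _ ≤ Q (∑ m ∈ F, d m) := by rw [div_le_iff₀ hC]; linarith

/-- The seminorm that `p` induces on coefficient sequences with respect to `x`. -/
def coeffSeminorm {X : Type*} [NormedAddCommGroup X] [NormedSpace ℝ X] (p : Seminorm ℝ X)
    (x : ℕ → X) : Seminorm ℝ (ℕ →₀ ℝ) :=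
  p.comp (Finsupp.linearCombination ℝ x)

/-! ### The constant `δ` as a supremum of lower estimates. -/

section Delta

variable {X : Type*} [NormedAddCommGroup X] [NormedSpace ℝ X]

theorem coeffSeminorm_apply (p : Seminorm ℝ X) (x : ℕ → X) (c : ℕ →₀ ℝ) :
    coeffSeminorm p x c = p (comb x c) := rfl

theorem coeffSeminorm_comp (p : Seminorm ℝ X) (x : ℕ → X) (M : ℕ → ℕ) :
    coeffSeminorm p (fun i => x (M i)) =
      (coeffSeminorm p x).comp (Finsupp.lmapDomain ℝ ℝ M) := by
  ext c
  simp only [coeffSeminorm_apply, Seminorm.comp_apply, Finsupp.lmapDomain_apply, comb,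
    Finsupp.linearCombination_mapDomain]
  rfl

theorem delta_eq {𝓕 : Set (Finset ℕ)} (h𝓕 : Regular 𝓕) (p : Seminorm ℝ X) (x : ℕ → X) :
    delta 𝓕 p x = sSup {δ | 0 ≤ δ ∧ LowerEstimate 𝓕 (coeffSeminorm p x) δ} := by
  simp only [delta, lowerEstimate_iff h𝓕, coeffSeminorm_apply, comb, map_sum]

/-- Testing on a single nonzero vector bounds the admissible constants, so the real supremum
defining `delta` is not the default value of an unbounded set. -/
theorem LowerEstimate.le_one {𝓕 : Set (Finset ℕ)} (h𝓕 : Regular 𝓕) {p : Seminorm ℝ X}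
    {x : ℕ → X} (hx : 0 < p (x 0)) {δ : ℝ} (h : LowerEstimate 𝓕 (coeffSeminorm p x) δ) :
    δ ≤ 1 := by
  have := h {0} (h𝓕.singleton_mem 0) (fun _ => Finsupp.single 0 1) (by simp) (by simp)
  simp only [Finset.sum_singleton, coeffSeminorm_apply, comb, Finsupp.linearCombination_single,
    one_smul] at this
  nlinarith

theorem delta_le_one {𝓕 : Set (Finset ℕ)} (h𝓕 : Regular 𝓕) {p : Seminorm ℝ X}
    {x : ℕ → X} (hx : 0 < p (x 0)) : delta 𝓕 p x ≤ 1 := by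
  rw [delta_eq h𝓕]
  exact Real.sSup_le (fun δ hδ => hδ.2.le_one h𝓕 hx) zero_le_one

theorem LowerEstimate.le_delta {𝓕 : Set (Finset ℕ)} (h𝓕 : Regular 𝓕) {p : Seminorm ℝ X}
    {x : ℕ → X} (hx : 0 < p (x 0)) {δ : ℝ} (hδ : 0 ≤ δ)
    (h : LowerEstimate 𝓕 (coeffSeminorm p x) δ) : δ ≤ delta 𝓕 p x := by
  rw [delta_eq h𝓕]
  exact le_csSup ⟨1, fun δ hδ => hδ.2.le_one h𝓕 hx⟩ ⟨hδ, h⟩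

theorem lowerEstimate_of_lt_delta {𝓕 : Set (Finset ℕ)} (h𝓕 : Regular 𝓕) {p : Seminorm ℝ X}
    {x : ℕ → X} {δ : ℝ} (hδ : 0 ≤ δ) (h : δ < delta 𝓕 p x) :
    LowerEstimate 𝓕 (coeffSeminorm p x) δ := by
  rw [delta_eq h𝓕] at h
  by_contra hcon
  refine h.not_ge (Real.sSup_le (fun δ' hδ' => ?_) hδ)
  by_contra! hlt
  exact hcon (hδ'.2.mono hlt.le)

theorem delta_nonneg (𝓕 : Set (Finset ℕ)) (p : Seminorm ℝ X) (x : ℕ → X) : 0 ≤ delta 𝓕 p x :=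
  Real.sSup_nonneg fun _ h => h.1

end Delta

/-! ### Renorming -/

/-- The restriction of a coefficient sequence to the interval `[u, v)`. -/
def restrictInterval (u v : ℕ) : (ℕ →₀ ℝ) →ₗ[ℝ] (ℕ →₀ ℝ) where
  toFun c := c.filter fun j => u ≤ j ∧ j < v
  map_add' _ _ := Finsupp.filter_add
  map_smul' _ _ := Finsupp.filter_smul

theorem restrictInterval_apply (u v : ℕ) (c : ℕ →₀ ℝ) (j : ℕ) :
    restrictInterval u v c j = if u ≤ j ∧ j < v then c j else 0 :=
  Finsupp.filter_apply _ _ _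

/-- `J` is a finite set of nonempty disjoint intervals `[u, v)`, coded by the pairs `(u, v)`,
whose left end points form a set in `𝓖`. -/
structure IsIntervals (𝓖 : Set (Finset ℕ)) (J : Finset (ℕ × ℕ)) : Prop where
  image_fst_mem : J.image Prod.fst ∈ 𝓖
  fst_lt_snd : ∀ p ∈ J, p.1 < p.2
  disjoint : ∀ p ∈ J, ∀ q ∈ J, p ≠ q → p.2 ≤ q.1 ∨ q.2 ≤ p.1

theorem IsIntervals.snd_le_fst {𝓖 : Set (Finset ℕ)} {J : Finset (ℕ × ℕ)} (hJ : IsIntervals 𝓖 J)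
    {p q : ℕ × ℕ} (hp : p ∈ J) (hq : q ∈ J) (h : p.1 < q.1) : p.2 ≤ q.1 := by
  rcases hJ.disjoint p hp q hq (fun h' => h.ne (congrArg _ h')) with h' | h'
  · exact h'
  · have := hJ.fst_lt_snd q hq
    omega

theorem IsIntervals.injOn_fst {𝓖 : Set (Finset ℕ)} {J : Finset (ℕ × ℕ)} (hJ : IsIntervals 𝓖 J) :
    Set.InjOn Prod.fst (J : Set (ℕ × ℕ)) := by
  intro p hp q hq h
  by_contra hne
  have h₁ := hJ.fst_lt_snd p hp
  have h₂ := hJ.fst_lt_snd q hq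
  rcases hJ.disjoint p hp q hq hne with h' | h' <;> omega

/-- The seminorm `∑ P (E c)`, the sum being over the intervals `E` in `J`. -/
def intervalSeminorm (P : Seminorm ℝ (ℕ →₀ ℝ)) (J : Finset (ℕ × ℕ)) : Seminorm ℝ (ℕ →₀ ℝ) :=
  ∑ p ∈ J, P.comp (restrictInterval p.1 p.2)

theorem intervalSeminorm_apply (P : Seminorm ℝ (ℕ →₀ ℝ)) (J : Finset (ℕ × ℕ)) (c : ℕ →₀ ℝ) :
    intervalSeminorm P J c = ∑ p ∈ J, P (restrictInterval p.1 p.2 c) := by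
  simp [intervalSeminorm]

/-- Enlarge each interval to the right up to the next left end and apply the lower estimate to the
pieces. One factor `K` cuts the pieces back to the intervals; `1 + K` bounds the removal of the part
of `c` before the first left end. -/
theorem IsIntervals.intervalSeminorm_le {𝓖 : Set (Finset ℕ)} {P : Seminorm ℝ (ℕ →₀ ℝ)} {K d : ℝ}
    (hK : 0 ≤ K) (hP : ∀ (m : ℕ) (c : ℕ →₀ ℝ), P (restrictInterval 0 m c) ≤ K * P c)
    (hd : 0 < d) (h : LowerEstimate 𝓖 P d) {J : Finset (ℕ × ℕ)} (hJ : IsIntervals 𝓖 J)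
    (c : ℕ →₀ ℝ) : intervalSeminorm P J c ≤ K * (1 + K) / d * P c := by
  classical
  rcases J.eq_empty_or_nonempty with rfl | hne
  · simp only [intervalSeminorm_apply, Finset.sum_empty]
    have := apply_nonneg P c
    positivity
  set F := J.image Prod.fst with hF
  have hFne : F.Nonempty := hne.image _
  let D : ℕ → ℕ →₀ ℝ := fun m => c.filter fun j => m ≤ j ∧ ∀ m' ∈ F, m < m' → j < m'
  have hD : ∀ m j, D m j = if m ≤ j ∧ ∀ m' ∈ F, m < m' → j < m' then c j else 0 :=
    fun m j => Finsupp.filter_apply _ _ _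
  have hDsupp : ∀ m, ∀ j ∈ (D m).support, m ≤ j ∧ ∀ m' ∈ F, m < m' → j < m' := by
    intro m j hj
    by_contra hcon
    rw [Finsupp.mem_support_iff, hD, if_neg hcon] at hj
    exact hj rfl
  have hest := h F hJ.image_fst_mem D (fun m _ j hj => (hDsupp m j hj).1)
    (fun m _ m' hm' hmm j hj => (hDsupp m j hj).2 m' hm' hmm)
  -- The pieces tile everything from `min F` on: `j` lies in the piece of the largest `m₀ ∈ F` with
  -- `m₀ ≤ j`.
  have hsum : ∑ m ∈ F, D m = c - restrictInterval 0 (F.min' hFne) c := by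
    ext j
    rw [Finsupp.finsetSum_apply, Finsupp.sub_apply, restrictInterval_apply]
    by_cases hj : j < F.min' hFne
    · rw [if_pos ⟨Nat.zero_le _, hj⟩, sub_self]
      refine Finset.sum_eq_zero fun m hm => ?_
      rw [hD, if_neg]
      intro hcon
      have := F.min'_le m hm
      omega
    · rw [if_neg fun h => hj h.2, sub_zero]
      push Not at hj
      have hne' : (F.filter (· ≤ j)).Nonempty :=
        ⟨_, Finset.mem_filter.2 ⟨F.min'_mem hFne, hj⟩⟩
      have hmem := (F.filter (· ≤ j)).max'_mem hne'
      set m₀ := (F.filter (· ≤ j)).max' hne'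
      rw [Finset.mem_filter] at hmem
      have hmax : ∀ m ∈ F, m ≤ j → m ≤ m₀ := fun m hm hmj =>
        (F.filter (· ≤ j)).le_max' m (Finset.mem_filter.2 ⟨hm, hmj⟩)
      rw [Finset.sum_eq_single_of_mem m₀ hmem.1, hD, if_pos]
      · refine ⟨hmem.2, fun m' hm' hlt => ?_⟩
        by_contra! hcon
        have := hmax m' hm' hcon
        omega
      · intro m hm hne
        rw [hD, if_neg]
        rintro ⟨hmj, hcon⟩
        have h₁ := hmax m hm hmj
        have h₂ := hcon m₀ hmem.1 (lt_of_le_of_ne h₁ hne)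
        omega
  have hterm : ∀ p ∈ J, P (restrictInterval p.1 p.2 c) ≤ K * P (D p.1) := by
    intro p hp
    convert hP p.2 (D p.1) using 2
    ext j
    rw [restrictInterval_apply, restrictInterval_apply, hD]
    have : p.1 ≤ j ∧ j < p.2 ↔ (0 ≤ j ∧ j < p.2) ∧ (p.1 ≤ j ∧ ∀ m' ∈ F, p.1 < m' → j < m') := by
      constructor
      · rintro ⟨h₁, h₂⟩
        refine ⟨⟨Nat.zero_le _, h₂⟩, h₁, fun m' hm' hlt => ?_⟩
        obtain ⟨q, hq, rfl⟩ := Finset.mem_image.1 hm'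
        exact h₂.trans_le (hJ.snd_le_fst hp hq hlt)
      · rintro ⟨h₁, h₂⟩
        exact ⟨h₂.1, h₁.2⟩
    rw [← ite_and]
    exact if_congr this rfl rfl
  have hsub : P (c - restrictInterval 0 (F.min' hFne) c) ≤ (1 + K) * P c := by
    have := map_sub_le_add P c (restrictInterval 0 (F.min' hFne) c)
    have := hP (F.min' hFne) c
    linarith
  rw [hsum] at hest
  calc intervalSeminorm P J c ≤ ∑ p ∈ J, K * P (D p.1) := by
        rw [intervalSeminorm_apply]
        exact Finset.sum_le_sum hterm
    _ = K * ∑ m ∈ F, P (D m) := by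
        rw [← Finset.mul_sum, hF, Finset.sum_image hJ.injOn_fst]
    _ ≤ K * ((1 + K) * P c / d) := by
        gcongr
        rw [le_div_iff₀ hd]
        linarith
    _ = _ := by ring

/-- Intersecting with `[u, v)` moves left ends to the right and deletes intervals that become empty,
so regularity keeps the left ends in `𝓖`. -/
theorem IsIntervals.exists_truncation {𝓖 : Set (Finset ℕ)} (h𝓖 : Regular 𝓖)
    (P : Seminorm ℝ (ℕ →₀ ℝ)) {J : Finset (ℕ × ℕ)} (hJ : IsIntervals 𝓖 J) (u v : ℕ) :
    ∃ J', IsIntervals 𝓖 J' ∧ (∀ p ∈ J', u ≤ p.1 ∧ p.2 ≤ v) ∧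
      ∀ c : ℕ →₀ ℝ, (∀ j ∈ c.support, u ≤ j ∧ j < v) →
        intervalSeminorm P J' c = intervalSeminorm P J c := by
  classical
  let φ : ℕ × ℕ → ℕ × ℕ := fun p => (max p.1 u, min p.2 v)
  set J₀ := J.filter fun p => max p.1 u < min p.2 v with hJ₀
  have hJ₀J : ∀ p ∈ J₀, p ∈ J ∧ max p.1 u < min p.2 v := fun p hp => by simpa [hJ₀] using hp
  have hdisj : ∀ p ∈ J₀, ∀ q ∈ J₀, p ≠ q → (φ p).2 ≤ (φ q).1 ∨ (φ q).2 ≤ (φ p).1 := by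
    intro p hp q hq hne
    rcases hJ.disjoint p (hJ₀J p hp).1 q (hJ₀J q hq).1 hne with h | h
    · exact Or.inl ((min_le_left _ _).trans (h.trans (le_max_left _ _)))
    · exact Or.inr ((min_le_left _ _).trans (h.trans (le_max_left _ _)))
  have hinj : Set.InjOn φ (J₀ : Set (ℕ × ℕ)) := by
    intro p hp q hq h
    by_contra hne
    have h₁ : (φ p).1 < (φ p).2 := (hJ₀J p hp).2
    have h₂ : (φ q).1 < (φ q).2 := (hJ₀J q hq).2
    have := hdisj p hp q hq hne
    rw [h] at this
    omega
  refine ⟨J₀.image φ, ⟨?_, ?_, ?_⟩, ?_, ?_⟩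
  · have : (J₀.image φ).image Prod.fst = (J₀.image Prod.fst).image fun m => max m u := by
      rw [Finset.image_image, Finset.image_image]
      rfl
    rw [this]
    refine h𝓖.image_mem _ hJ.image_fst_mem _ (Finset.image_subset_image (Finset.filter_subset _ _))
      _ ?_ (fun m _ => le_max_left _ _)
    intro m hm m' hm' hmm
    rw [Finset.mem_coe, Finset.mem_image] at hm hm'
    obtain ⟨p, hp, rfl⟩ := hm
    obtain ⟨q, hq, rfl⟩ := hm'
    have h₁ := hJ.snd_le_fst (hJ₀J p hp).1 (hJ₀J q hq).1 hmm
    have h₂ := (hJ₀J p hp).2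
    show max p.1 u < max q.1 u
    omega
  · simp only [Finset.forall_mem_image]
    exact fun p hp => (hJ₀J p hp).2
  · simp only [Finset.forall_mem_image]
    exact fun p hp q hq hne => hdisj p hp q hq fun h => hne (congrArg φ h)
  · simp only [Finset.forall_mem_image]
    exact fun p _ => ⟨le_max_right _ _, min_le_right _ _⟩
  · intro c hc
    have hres : ∀ p : ℕ × ℕ,
        restrictInterval (φ p).1 (φ p).2 c = restrictInterval p.1 p.2 c := by
      intro p
      ext j
      rw [restrictInterval_apply, restrictInterval_apply]
      by_cases hj : c j = 0
      · simp [hj]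
      · have := hc j (Finsupp.mem_support_iff.2 hj)
        refine if_congr ?_ rfl rfl
        simp only [φ]
        omega
    rw [intervalSeminorm_apply, intervalSeminorm_apply, Finset.sum_image hinj, hJ₀,
      Finset.sum_filter_of_ne]
    · exact Finset.sum_congr rfl fun p _ => by rw [hres]
    · intro p _ hp
      rw [hres] at hp
      by_contra hcon
      refine hp ?_
      have : restrictInterval p.1 p.2 c = 0 := by
        ext j
        rw [restrictInterval_apply]
        by_cases hj : c j = 0
        · simp [hj]
        · have := hc j (Finsupp.mem_support_iff.2 hj)
          rw [if_neg (by omega)]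
          rfl
      rw [this, map_zero]

/-- After truncation to the supports of the `d m`, the systems `J m` follow one another and do not
see the other vectors; their union has left ends in the composition. -/
theorem exists_isIntervals_compFamily {𝓕 𝓖 : Set (Finset ℕ)} (h𝓕 : Regular 𝓕) (h𝓖 : Regular 𝓖)
    (P : Seminorm ℝ (ℕ →₀ ℝ)) {A : Finset ℕ} (hA : A ∈ 𝓕) (d : ℕ → ℕ →₀ ℝ)
    (hle : ∀ m ∈ A, ∀ j ∈ (d m).support, m ≤ j)
    (hlt : ∀ m ∈ A, ∀ m' ∈ A, m < m' → ∀ j ∈ (d m).support, j < m')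
    (J : ℕ → Finset (ℕ × ℕ)) (hJ : ∀ m ∈ A, IsIntervals 𝓖 (J m)) :
    ∃ J', IsIntervals (compFamily 𝓕 𝓖) J' ∧
      intervalSeminorm P J' (∑ m ∈ A, d m) = ∑ m ∈ A, intervalSeminorm P (J m) (d m) := by
  classical
  let v : ℕ → ℕ := fun m => (d m).support.sup (· + 1)
  have hv : ∀ m, ∀ j ∈ (d m).support, j < v m := fun m j hj =>
    Finset.le_sup (f := (· + 1)) hj
  have hv' : ∀ m ∈ A, ∀ m' ∈ A, m < m' → v m ≤ m' := fun m hm m' hm' hmm =>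
    Finset.sup_le fun j hj => hlt m hm m' hm' hmm j hj
  have htr : ∀ m, ∃ I : Finset (ℕ × ℕ), m ∈ A → IsIntervals 𝓖 I ∧
      (∀ p ∈ I, m ≤ p.1 ∧ p.2 ≤ v m) ∧
        intervalSeminorm P I (d m) = intervalSeminorm P (J m) (d m) := by
    intro m
    by_cases hm : m ∈ A
    · obtain ⟨I, h₁, h₂, h₃⟩ := (hJ m hm).exists_truncation h𝓖 P m (v m)
      exact ⟨I, fun _ => ⟨h₁, h₂, h₃ (d m) fun j hj => ⟨hle m hm j hj, hv m j hj⟩⟩⟩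
    · exact ⟨∅, fun h => (hm h).elim⟩
  choose I hI using htr
  have hsep : ∀ m ∈ A, ∀ m' ∈ A, m < m' → ∀ p ∈ I m, ∀ q ∈ I m', p.2 ≤ q.1 :=
    fun m hm m' hm' hmm p hp q hq =>
      (((hI m hm).2.1 p hp).2.trans (hv' m hm m' hm' hmm)).trans ((hI m' hm').2.1 q hq).1
  have hdisj : (A : Set ℕ).PairwiseDisjoint I := by
    intro m hm m' hm' hne
    refine Finset.disjoint_left.2 fun p hp hp' => ?_
    have h₁ := (hI m hm).1.fst_lt_snd p hp
    rcases hne.lt_or_gt with h | h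
    · have := hsep m hm m' hm' h p hp p hp'
      omega
    · have := hsep m' hm' m hm h p hp' p hp
      omega
  refine ⟨A.biUnion I, ⟨?_, ?_, ?_⟩, ?_⟩
  · rw [Finset.biUnion_image]
    refine mem_compFamily h𝓕 hA _ (fun m hm => (hI m hm).1.image_fst_mem) ?_ ?_
    · intro m hm
      simp only [Finset.forall_mem_image]
      exact fun p hp => ((hI m hm).2.1 p hp).1
    · intro m hm m' hm' hmm
      simp only [Finset.forall_mem_image]
      intro p hp q hq
      exact ((hI m hm).1.fst_lt_snd p hp).trans_le (hsep m hm m' hm' hmm p hp q hq)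
  · intro p hp
    obtain ⟨m, hm, hp⟩ := Finset.mem_biUnion.1 hp
    exact (hI m hm).1.fst_lt_snd p hp
  · intro p hp q hq hne
    obtain ⟨m, hm, hp⟩ := Finset.mem_biUnion.1 hp
    obtain ⟨m', hm', hq⟩ := Finset.mem_biUnion.1 hq
    rcases lt_trichotomy m m' with h | rfl | h
    · exact Or.inl (hsep m hm m' hm' h p hp q hq)
    · exact (hI m hm).1.disjoint p hp q hq hne
    · exact Or.inr (hsep m' hm' m hm h q hq p hp)
  · rw [intervalSeminorm_apply, Finset.sum_biUnion hdisj]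
    refine Finset.sum_congr rfl fun m hm => ?_
    rw [← (hI m hm).2.2, intervalSeminorm_apply]
    refine Finset.sum_congr rfl fun p hp => ?_
    rw [map_sum, Finset.sum_eq_single_of_mem m hm]
    intro m' hm' hne
    ext j
    rw [restrictInterval_apply]
    by_cases hj : d m' j = 0
    · simp [hj]
    · rw [if_neg]
      · rfl
      · have hj := Finsupp.mem_support_iff.2 hj
        have hp := (hI m hm).2.1 p hp
        rcases hne.lt_or_gt with h | h
        · have := hlt m' hm' m hm h j hj
          omega
        · have h₁ := hle m' hm' j hj
          have h₂ := hv' m hm m' hm' h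
          omega

/-- The supremum of `∑ P (E c)` over all finite sets of intervals `E` in the sense of
`IsIntervals 𝓖`. -/
def levelSeminorm (P : Seminorm ℝ (ℕ →₀ ℝ)) (𝓖 : Set (Finset ℕ)) : Seminorm ℝ (ℕ →₀ ℝ) :=
  ⨆ J : {J // IsIntervals 𝓖 J}, intervalSeminorm P J

/-! ### The level seminorms. The bound by `C * P` makes their suprema genuine. -/

section Level

variable {P : Seminorm ℝ (ℕ →₀ ℝ)} {𝓕 𝓖 : Set (Finset ℕ)} {C : ℝ}

theorem isIntervals_empty (h𝓖 : Regular 𝓖) : IsIntervals 𝓖 ∅ :=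
  ⟨by simpa using h𝓖.empty_mem, by simp, by simp⟩

theorem levelSeminorm_apply (h : ∀ J, IsIntervals 𝓖 J → ∀ c, intervalSeminorm P J c ≤ C * P c)
    (c : ℕ →₀ ℝ) :
    levelSeminorm P 𝓖 c = ⨆ J : {J // IsIntervals 𝓖 J}, intervalSeminorm P J c := by
  refine Seminorm.iSup_apply (Seminorm.bddAbove_range_iff.2 fun c => ⟨C * P c, ?_⟩)
  rintro _ ⟨J, rfl⟩
  exact h J J.2 c

theorem levelSeminorm_le (h𝓖 : Regular 𝓖)
    (h : ∀ J, IsIntervals 𝓖 J → ∀ c, intervalSeminorm P J c ≤ C * P c) (c : ℕ →₀ ℝ) :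
    levelSeminorm P 𝓖 c ≤ C * P c := by
  have : Nonempty {J // IsIntervals 𝓖 J} := ⟨⟨∅, isIntervals_empty h𝓖⟩⟩
  rw [levelSeminorm_apply h]
  exact ciSup_le fun J => h J J.2 c

theorem le_levelSeminorm (h : ∀ J, IsIntervals 𝓖 J → ∀ c, intervalSeminorm P J c ≤ C * P c)
    {J : Finset (ℕ × ℕ)} (hJ : IsIntervals 𝓖 J) (c : ℕ →₀ ℝ) :
    intervalSeminorm P J c ≤ levelSeminorm P 𝓖 c := by
  rw [levelSeminorm_apply h]
  refine le_ciSup (f := fun J : {J // IsIntervals 𝓖 J} => intervalSeminorm P J c)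
    ⟨C * P c, ?_⟩ ⟨J, hJ⟩
  rintro _ ⟨J, rfl⟩
  exact h J J.2 c

theorem apply_le_levelSeminorm (h𝓖 : Regular 𝓖)
    (h : ∀ J, IsIntervals 𝓖 J → ∀ c, intervalSeminorm P J c ≤ C * P c) (c : ℕ →₀ ℝ) :
    P c ≤ levelSeminorm P 𝓖 c := by
  -- One interval containing the support of `c`; the final `+ 1` keeps it nonempty when `c = 0`.
  have hJ : IsIntervals 𝓖 {(0, c.support.sup (· + 1) + 1)} :=
    ⟨by simpa using h𝓖.singleton_mem 0, by simp, by simp⟩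
  refine le_trans (le_of_eq ?_) (le_levelSeminorm h hJ c)
  rw [intervalSeminorm_apply, Finset.sum_singleton]
  congr 1
  ext j
  rw [restrictInterval_apply]
  by_cases hj : c j = 0
  · simp [hj]
  · have : j + 1 ≤ c.support.sup (· + 1) :=
      Finset.le_sup (f := (· + 1)) (Finsupp.mem_support_iff.2 hj)
    rw [if_pos (by omega)]

theorem sum_levelSeminorm_le (h𝓕 : Regular 𝓕) (h𝓖 : Regular 𝓖)
    (h : ∀ J, IsIntervals 𝓖 J → ∀ c, intervalSeminorm P J c ≤ C * P c)
    (h' : ∀ J, IsIntervals (compFamily 𝓕 𝓖) J → ∀ c, intervalSeminorm P J c ≤ C * P c)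
    {A : Finset ℕ} (hA : A ∈ 𝓕) (d : ℕ → ℕ →₀ ℝ)
    (hle : ∀ m ∈ A, ∀ j ∈ (d m).support, m ≤ j)
    (hlt : ∀ m ∈ A, ∀ m' ∈ A, m < m' → ∀ j ∈ (d m).support, j < m') :
    ∑ m ∈ A, levelSeminorm P 𝓖 (d m) ≤ levelSeminorm P (compFamily 𝓕 𝓖) (∑ m ∈ A, d m) := by
  have : Nonempty {J // IsIntervals 𝓖 J} := ⟨⟨∅, isIntervals_empty h𝓖⟩⟩
  refine le_of_forall_pos_le_add fun ε hε => ?_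
  have key : ∀ m, ∃ J : {J // IsIntervals 𝓖 J},
      levelSeminorm P 𝓖 (d m) - ε / (A.card + 1) < intervalSeminorm P J (d m) := by
    intro m
    rw [levelSeminorm_apply h]
    exact exists_lt_of_lt_ciSup (sub_lt_self _ (by positivity))
  choose J hJ using key
  obtain ⟨J', hJ', heq⟩ := exists_isIntervals_compFamily h𝓕 h𝓖 P hA d hle hlt
    (fun m => (J m : Finset (ℕ × ℕ))) (fun m _ => (J m).2)
  calc ∑ m ∈ A, levelSeminorm P 𝓖 (d m)
      ≤ ∑ m ∈ A, (intervalSeminorm P (J m) (d m) + ε / (A.card + 1)) :=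
        Finset.sum_le_sum fun m _ => by linarith [hJ m]
    _ = intervalSeminorm P J' (∑ m ∈ A, d m) + A.card * (ε / (A.card + 1)) := by
        rw [Finset.sum_add_distrib, heq, Finset.sum_const, nsmul_eq_mul]
    _ ≤ _ := by
        refine add_le_add (le_levelSeminorm h' hJ' _) ?_
        rw [mul_div_assoc', div_le_iff₀ (by positivity)]
        nlinarith

end Level

/-- Summing over an admissible family raises level `j` to level `j + 1`, and the weights `θ ^ j`
turn this shift into the factor `θ`. Finitely many levels suffice because the overflow at level `n +
1` is absorbed by level `0`. -/
theorem exists_renorming {𝓕 : Set (Finset ℕ)} (h𝓕 : Regular 𝓕) {P : Seminorm ℝ (ℕ →₀ ℝ)}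
    {K d : ℝ} (hK : 0 ≤ K) (hP : ∀ (m : ℕ) (c : ℕ →₀ ℝ), P (restrictInterval 0 m c) ≤ K * P c)
    (hd : 0 < d) {n : ℕ} (h : LowerEstimate (iterFamily 𝓕 (n + 1)) P d) (θ : NNReal)
    (hθ : (θ : ℝ) ^ (n + 1) * (K * (1 + K) / d) ≤ 1) :
    ∃ (N : Seminorm ℝ (ℕ →₀ ℝ)) (C : ℝ), (∀ c, P c ≤ N c ∧ N c ≤ C * P c) ∧
      LowerEstimate 𝓕 N θ := by
  set C := K * (1 + K) / d with hC
  let L : ℕ → Seminorm ℝ (ℕ →₀ ℝ) := fun j => levelSeminorm P (iterFamily 𝓕 j)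
  have hbound : ∀ j ≤ n + 1, ∀ J, IsIntervals (iterFamily 𝓕 j) J →
      ∀ c, intervalSeminorm P J c ≤ C * P c := fun j hj J hJ c =>
    hJ.intervalSeminorm_le hK hP hd (h.mono_family (iterFamily_mono h𝓕 hj)) c
  let N : Seminorm ℝ (ℕ →₀ ℝ) := ∑ j ∈ Finset.range (n + 1), θ ^ j • L j
  have hN : ∀ c, N c = ∑ j ∈ Finset.range (n + 1), (θ : ℝ) ^ j * L j c := by
    intro c
    simp [N, NNReal.smul_def]
  have hPL : ∀ c, P c ≤ L 0 c := fun c =>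
    apply_le_levelSeminorm (h𝓕.iterFamily 0) (hbound 0 (Nat.zero_le _)) c
  refine ⟨N, ∑ j ∈ Finset.range (n + 1), (θ : ℝ) ^ j * C, fun c => ⟨?_, ?_⟩, ?_⟩
  · rw [hN]
    calc P c ≤ (θ : ℝ) ^ 0 * L 0 c := by simpa using hPL c
      _ ≤ _ := Finset.single_le_sum (f := fun j => (θ : ℝ) ^ j * L j c)
        (fun j _ => mul_nonneg (by positivity) (apply_nonneg _ _)) (by simp)
  · rw [hN, Finset.sum_mul]
    refine Finset.sum_le_sum fun j hj => ?_
    rw [mul_assoc]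
    gcongr
    exact levelSeminorm_le (h𝓕.iterFamily j) (hbound j (Finset.mem_range.1 hj).le) c
  · intro A hA x hle hlt
    have hstep : ∀ j ≤ n, ∑ m ∈ A, L j (x m) ≤ L (j + 1) (∑ m ∈ A, x m) := fun j hj =>
      sum_levelSeminorm_le h𝓕 (h𝓕.iterFamily j) (hbound j (by omega)) (hbound (j + 1) (by omega))
        hA x hle hlt
    -- Level `n + 1` is not a summand of `N`. It is at most `C * P`, and `hθ` makes `θ ^ (n + 1) * C
    -- ≤ 1`.
    have hlast : (θ : ℝ) ^ (n + 1) * ∑ m ∈ A, L n (x m) ≤ L 0 (∑ m ∈ A, x m) :=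
      calc (θ : ℝ) ^ (n + 1) * ∑ m ∈ A, L n (x m)
          ≤ (θ : ℝ) ^ (n + 1) * (C * P (∑ m ∈ A, x m)) := by
            gcongr
            exact (hstep n le_rfl).trans
              (levelSeminorm_le (h𝓕.iterFamily _) (hbound _ le_rfl) _)
        _ = ((θ : ℝ) ^ (n + 1) * C) * P (∑ m ∈ A, x m) := by ring
        _ ≤ 1 * P (∑ m ∈ A, x m) := by gcongr
        _ ≤ _ := by simpa using hPL _
    simp only [hN]
    -- The left side splits off its last level `n`, the right side its level `0`; the remaining
    -- terms match after the shift `j ↦ j + 1`.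
    rw [Finset.sum_comm, Finset.mul_sum, Finset.sum_range_succ, Finset.sum_range_succ']
    refine add_le_add (Finset.sum_le_sum fun j hj => ?_) ?_
    · rw [← Finset.mul_sum, ← mul_assoc, ← pow_succ']
      gcongr
      exact hstep j (Finset.mem_range.1 hj).le
    · rw [← Finset.mul_sum, ← mul_assoc, ← pow_succ']
      simpa using hlast

/-- A norm on (the domain of parametrization of) a subspace that is equivalent to the given one
extends to an equivalent norm on the whole space. -/
theorem exists_isEquivalentNorm_extension {V E : Type*} [AddCommGroup V] [Module ℝ V]
    [NormedAddCommGroup E] [NormedSpace ℝ E] (T : V →ₗ[ℝ] E) (N : Seminorm ℝ V) (C : ℝ)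
    (hN : ∀ c, ‖T c‖ ≤ N c ∧ N c ≤ C * ‖T c‖) :
    ∃ q : Seminorm ℝ E, IsEquivalentNorm q ∧ ∀ c, q (T c) = N c := by
  set B := max C 1 with hB
  have hB1 : 1 ≤ B := le_max_right _ _
  have hNB : ∀ c, N c ≤ B * ‖T c‖ := fun c => (hN c).2.trans (by gcongr; exact le_max_left _ _)
  have hpos : ∀ (u : E) (c : V), 0 ≤ N c + B * ‖u - T c‖ := fun u c =>
    add_nonneg (apply_nonneg _ _) (by positivity)
  have hbdd : ∀ u : E, BddBelow (Set.range fun c => N c + B * ‖u - T c‖) := fun u =>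
    ⟨0, by rintro _ ⟨c, rfl⟩; exact hpos u c⟩
  -- Infimal convolution of `N`, carried over by `T`, with `B * ‖·‖`. Having `B ≥ 1` makes it
  -- dominate the norm, and `N ≤ B * ‖T ·‖` makes it agree with `N` on the range of `T`.
  let q : Seminorm ℝ E := Seminorm.ofSMulLE (fun u => ⨅ c, N c + B * ‖u - T c‖)
    (le_antisymm (ciInf_le_of_le (hbdd 0) 0 (by simp)) (le_ciInf fun c => hpos 0 c))
    (fun u v => by
      refine le_ciInf_add_ciInf fun c c' => ciInf_le_of_le (hbdd _) (c + c') ?_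
      have h₁ := map_add_le_add N c c'
      have h₂ : ‖u + v - T (c + c')‖ ≤ ‖u - T c‖ + ‖v - T c'‖ := by
        rw [map_add, add_sub_add_comm]
        exact norm_add_le _ _
      nlinarith)
    (fun r u => by
      rw [Real.mul_iInf_of_nonneg (norm_nonneg r)]
      refine le_ciInf fun c => ciInf_le_of_le (hbdd _) (r • c) ?_
      rw [map_smul_eq_mul, map_smul, ← smul_sub, norm_smul]
      exact le_of_eq (by ring))
  have hq : ∀ u, q u = ⨅ c, N c + B * ‖u - T c‖ := fun u => rfl
  refine ⟨q, ⟨1, B, one_pos, fun u => ⟨?_, ?_⟩⟩, fun c => le_antisymm ?_ ?_⟩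
  · rw [hq, one_mul]
    refine le_ciInf fun c => ?_
    have h₁ : ‖u‖ ≤ ‖T c‖ + ‖u - T c‖ := by
      simpa using norm_add_le (T c) (u - T c)
    have h₂ := (hN c).1
    nlinarith [norm_nonneg (u - T c)]
  · rw [hq]
    exact ciInf_le_of_le (hbdd u) 0 (by simp)
  · rw [hq]
    exact ciInf_le_of_le (hbdd _) c (by simp)
  · rw [hq]
    refine le_ciInf fun c' => ?_
    have h₁ := map_add_le_add N c' (c - c')
    have h₂ := hNB (c - c')
    rw [LinearMap.map_sub] at h₂
    rw [add_sub_cancel] at h₁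
    linarith

/-! ### Block bases of Schauder bases -/

section BlockBasis

variable {X : Type*} [NormedAddCommGroup X] [NormedSpace ℝ X]

theorem linearCombination_apply_of_successive {b : ℕ → ℕ →₀ ℝ}
    (hb : Successive fun i => (b i).support) (c : ℕ →₀ ℝ) {i j : ℕ} (hj : j ∈ (b i).support) :
    Finsupp.linearCombination ℝ b c j = c i * b i j := by
  rw [Finsupp.linearCombination_apply, Finsupp.sum, Finsupp.finsetSum_apply]
  rw [Finset.sum_eq_single i]
  · rfl
  · intro k _ hk
    have : b k j = 0 := by
      by_contra hne
      have hk' := Finsupp.mem_support_iff.2 hne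
      rcases hk.lt_or_gt with h | h
      · exact lt_irrefl _ (hb.2 k i h j hk' j hj)
      · exact lt_irrefl _ (hb.2 i k h j hj j hk')
    simp [this]
  · intro hi
    simp [Finsupp.notMem_support_iff.1 hi]

theorem comb_eq_comb_linearCombination {e x : ℕ → X} {b : ℕ → ℕ →₀ ℝ}
    (hx : ∀ i, x i = comb e (b i)) (c : ℕ →₀ ℝ) :
    comb x c = comb e (Finsupp.linearCombination ℝ b c) := by
  obtain rfl : x = fun i => comb e (b i) := funext hx
  induction c using Finsupp.induction_linear with
  | zero => simp [comb]
  | add c c' h h' => simp only [comb, map_add] at h h' ⊢; rw [h, h']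
  | single i r => simp [comb]

theorem IsBlockBasis.comb_ne_zero {e x : ℕ → X} (he : LinearIndependent ℝ e)
    (hx : IsBlockBasis e x) {c : ℕ →₀ ℝ} (hc : c ≠ 0) : comb x c ≠ 0 := by
  obtain ⟨b, hb, hxb⟩ := hx
  intro h0
  rw [comb_eq_comb_linearCombination hxb] at h0
  have hz := linearIndependent_iff.1 he _ h0
  refine hc (Finsupp.ext fun i => ?_)
  obtain ⟨j, hj⟩ := hb.1 i
  have h := linearCombination_apply_of_successive hb c hj
  rw [hz, Finsupp.zero_apply, eq_comm, mul_eq_zero] at h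
  exact h.resolve_right (Finsupp.mem_support_iff.1 hj)

theorem IsBlockBasis.comp_strictMono {e x : ℕ → X} (hx : IsBlockBasis e x) {M : ℕ → ℕ}
    (hM : StrictMono M) : IsBlockBasis e fun i => x (M i) := by
  obtain ⟨b, hb, hxb⟩ := hx
  exact ⟨fun i => b (M i), ⟨fun i => hb.1 _, fun i j hij => hb.2 _ _ (hM hij)⟩, fun i => hxb _⟩

theorem isBlockBasis_subseq (x : ℕ → X) {M : ℕ → ℕ} (hM : StrictMono M) :
    IsBlockBasis x fun i => x (M i) := by
  refine ⟨fun i => Finsupp.single (M i) 1, ⟨fun i => ?_, fun i j hij => ?_⟩, fun i => ?_⟩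
  · simp
  · simpa [Finsupp.support_single] using hM hij
  · simp [comb]

theorem Successive.le {G : ℕ → Finset ℕ} (hG : Successive G) (i : ℕ) : ∀ j ∈ G i, i ≤ j := by
  induction i with
  | zero => exact fun _ _ => Nat.zero_le _
  | succ i ih =>
    intro j hj
    obtain ⟨k, hk⟩ := hG.1 i
    have h₁ := ih k hk
    have h₂ := hG.2 i (i + 1) (Nat.lt_succ_self i) k hk j hj
    omega

/-- The `i`-th block of a block basis is supported in `[i, ∞)`, so dropping `n` blocks leaves a
block basis of the tail from `n`. -/
theorem IsBlockBasis.tail {x z : ℕ → X} (hz : IsBlockBasis x z) {M : ℕ → ℕ} (hM : StrictMono M)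
    (n : ℕ) : IsBlockBasis (fun i => x (n + i)) fun i => z (M (n + i)) := by
  obtain ⟨b, hb, hzb⟩ := hz
  have hinj : Function.Injective fun i => n + i := fun i j h => by simpa using h
  have hmono : StrictMono fun i => M (n + i) := fun i j h => hM (by simpa using h)
  have hrange : ∀ i, ((b (M (n + i))).support : Set ℕ) ⊆ Set.range fun i => n + i := by
    intro i j hj
    have h₁ := hb.le _ j hj
    have h₂ : n + i ≤ M (n + i) := hM.le_apply
    exact ⟨j - n, by simp only; omega⟩
  have hmap : ∀ i, Finsupp.mapDomain (fun i => n + i)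
      (Finsupp.comapDomain (fun i => n + i) (b (M (n + i))) hinj.injOn) = b (M (n + i)) :=
    fun i => Finsupp.mapDomain_comapDomain _ hinj _ (hrange i)
  refine ⟨fun i => Finsupp.comapDomain (fun i => n + i) (b (M (n + i))) hinj.injOn,
    ⟨fun i => ?_, fun i j hij k hk k' hk' => ?_⟩, fun i => ?_⟩
  · obtain ⟨j, hj⟩ := hb.1 (M (n + i))
    obtain ⟨k, rfl⟩ := hrange i hj
    exact ⟨k, by simpa using hj⟩
  · simp only [Finsupp.comapDomain_support, Finset.mem_preimage] at hk hk'
    have := hb.2 _ _ (hmono hij) _ hk _ hk'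
    omega
  · calc z (M (n + i)) = comb x (b (M (n + i))) := hzb _
      _ = _ := by
        rw [← hmap i, comb, Finsupp.linearCombination_mapDomain]
        rfl

theorem norm_comb_restrictInterval_le {e : SchauderBasis ℝ X} {K : ℝ}
    (hK : ∀ n, ‖e.proj n‖ ≤ K) {x : ℕ → X} (hx : IsBlockBasis e.basis x) (m : ℕ) (c : ℕ →₀ ℝ) :
    ‖comb x (restrictInterval 0 m c)‖ ≤ K * ‖comb x c‖ := by
  obtain ⟨b, hb, hxb⟩ := hx
  -- `e.proj k` keeps the basis vectors of index less than `k`; with `k` the start of the `m`-th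
  -- block it keeps exactly the `x i` with `i < m`.
  obtain ⟨k, hk, hkmin⟩ : ∃ k ∈ (b m).support, ∀ j ∈ (b m).support, k ≤ j :=
    ⟨_, (b m).support.min'_mem (hb.1 m), fun j hj => Finset.min'_le _ j hj⟩
  have hproj : ∀ i, e.proj k (x i) = if i < m then x i else 0 := by
    intro i
    rw [hxb, comb, Finsupp.linearCombination_apply, Finsupp.sum, map_sum]
    split_ifs with h
    · refine Finset.sum_congr rfl fun j hj => ?_
      rw [map_smul, e.proj_apply_basis_mem, if_pos (hb.2 i m h j hj k hk)]
    · refine Finset.sum_eq_zero fun j hj => ?_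
      rw [map_smul, e.proj_apply_basis_mem, if_neg, smul_zero]
      rcases (not_lt.1 h).eq_or_lt with rfl | h
      · exact (hkmin j hj).not_gt
      · exact (hb.2 m i h k hk j hj).not_gt
  have key : comb x (restrictInterval 0 m c) = e.proj k (comb x c) := by
    induction c using Finsupp.induction_linear with
    | zero => simp [comb]
    | add c c' h h' => simp only [comb, map_add] at h h' ⊢; rw [h, h']
    | single i r =>
      have : restrictInterval 0 m (Finsupp.single i r) = if i < m then Finsupp.single i r else 0 := by
        ext j
        rw [restrictInterval_apply]
        by_cases hij : i = j
        · subst hij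
          split_ifs <;> simp_all
        · split_ifs <;> simp [Finsupp.single_eq_of_ne' hij]
      rw [this, comb, comb, Finsupp.linearCombination_single, map_smul, hproj]
      split_ifs <;> simp
  rw [key]
  exact (e.proj k).le_of_opNorm_le (hK k) _

/-! ### Block bases inside `[x_i]` and the suprema over them. -/

theorem coe_comb {x : ℕ → X} (z : ℕ → closedSpan x) (c : ℕ →₀ ℝ) :
    ((comb z c : closedSpan x) : X) = comb (fun i => (z i : X)) c := by
  simp only [comb]
  rw [← Submodule.subtype_apply, LinearMap.map_finsupp_linearCombination]
  rfl

theorem IsBlockBasis.coe {x : ℕ → X} {z : ℕ → closedSpan x} (hz : IsBlockBasis (inClosedSpan x) z) :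
    IsBlockBasis x fun i => (z i : X) := by
  obtain ⟨b, hb, hzb⟩ := hz
  exact ⟨b, hb, fun i => (congrArg Subtype.val (hzb i)).trans (coe_comb _ _)⟩

theorem IsBlockBasis.apply_ne_zero {e x y : ℕ → X} (he : LinearIndependent ℝ e)
    (hx : IsBlockBasis e x) (hy : IsBlockBasis x y) (i : ℕ) : y i ≠ 0 := by
  obtain ⟨b, hb, hyb⟩ := hy
  rw [hyb]
  exact hx.comb_ne_zero he (Finsupp.support_nonempty_iff.1 (hb.1 i))

theorem delta_le_one_of_isEquivalentNorm {𝓕 : Set (Finset ℕ)} (h𝓕 : Regular 𝓕) {e x : ℕ → X}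
    (he : LinearIndependent ℝ e) (hx : IsBlockBasis e x) {p : Seminorm ℝ (closedSpan x)}
    (hp : IsEquivalentNorm p) {z : ℕ → closedSpan x} (hz : IsBlockBasis (inClosedSpan x) z) :
    delta 𝓕 p z ≤ 1 ∧ 0 < p (z 0) := by
  obtain ⟨c, C, hc, hcC⟩ := hp
  have hz0 : 0 < p (z 0) := by
    refine lt_of_lt_of_le ?_ (hcC (z 0)).1
    have : z 0 ≠ 0 := fun h => hx.apply_ne_zero he hz.coe 0 (by simp [h])
    have := norm_pos_iff.2 this
    positivity
  exact ⟨delta_le_one h𝓕 hz0, hz0⟩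

theorem delta_le_ddotDelta {𝓕 : Set (Finset ℕ)} (h𝓕 : Regular 𝓕) {e x : ℕ → X}
    (he : LinearIndependent ℝ e) (hx : IsBlockBasis e x) {p : Seminorm ℝ (closedSpan x)}
    (hp : IsEquivalentNorm p) {z : ℕ → closedSpan x} (hz : IsBlockBasis (inClosedSpan x) z) :
    delta 𝓕 p z ≤ ddotDelta 𝓕 x := by
  have h₁ : ∀ q : Seminorm ℝ (closedSpan x), IsEquivalentNorm q →
      ∀ d ∈ {d : ℝ | ∃ y, IsBlockBasis (inClosedSpan x) y ∧ d = delta 𝓕 q y}, d ≤ 1 := by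
    rintro q hq d ⟨y, hy, rfl⟩
    exact (delta_le_one_of_isEquivalentNorm h𝓕 he hx hq hy).1
  calc delta 𝓕 p z ≤ dotDelta 𝓕 p (inClosedSpan x) := le_csSup ⟨1, h₁ p hp⟩ ⟨z, hz, rfl⟩
    _ ≤ ddotDelta 𝓕 x := by
      refine le_csSup ⟨1, ?_⟩ ⟨p, hp, rfl⟩
      rintro _ ⟨q, hq, rfl⟩
      exact Real.sSup_le (h₁ q hq) zero_le_one

theorem ddotDelta_nonneg (𝓕 : Set (Finset ℕ)) (x : ℕ → X) : 0 ≤ ddotDelta 𝓕 x := by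
  refine Real.sSup_nonneg ?_
  rintro _ ⟨p, -, rfl⟩
  refine Real.sSup_nonneg ?_
  rintro _ ⟨z, -, rfl⟩
  exact delta_nonneg _ _ _

/-- Boundedness is not needed: the default supremum `0` cannot exceed `d ≥ 0`. -/
theorem exists_lt_of_lt_sSup_of_nonneg {S : Set ℝ} {d : ℝ} (hd : 0 ≤ d) (h : d < sSup S) :
    ∃ s ∈ S, d < s := by
  by_contra! hcon
  exact h.not_ge (Real.sSup_le hcon hd)

theorem exists_lt_delta_of_lt_ddotDelta {𝓕 : Set (Finset ℕ)} {x : ℕ → X} {d : ℝ} (hd : 0 ≤ d)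
    (h : d < ddotDelta 𝓕 x) : ∃ (p : Seminorm ℝ (closedSpan x)) (z : ℕ → closedSpan x),
      IsEquivalentNorm p ∧ IsBlockBasis (inClosedSpan x) z ∧ d < delta 𝓕 p z := by
  obtain ⟨_, ⟨p, hp, rfl⟩, h⟩ := exists_lt_of_lt_sSup_of_nonneg hd h
  obtain ⟨_, ⟨z, hz, rfl⟩, h⟩ := exists_lt_of_lt_sSup_of_nonneg hd h
  exact ⟨p, z, hp, hz, h⟩

/-! ### Stabilizing sequences -/

section Stabilizing

variable {a : Ordinal.{0} → ℕ → Ordinal.{0}} {x : ℕ → X} {γ : Ordinal.{0} → ℝ}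

theorem DeltaStabilizes.exists_forall_abs_sub_lt (hγ : DeltaStabilizes a x γ) {β : Ordinal.{0}}
    (hβ : β < ω₁) {η : ℝ} (hη : 0 < η) : ∃ n, ∀ y, IsBlockBasis (fun i => x (n + i)) y →
      |delta (schreier a β) (normSeminorm ℝ X) y - γ β| < η := by
  obtain ⟨ε, -, hε, h⟩ := hγ
  obtain ⟨m, hm⟩ := h β hβ
  obtain ⟨n, hn, hmn⟩ := ((hε.eventually_lt_const hη).and (eventually_ge_atTop m)).exists
  exact ⟨n, fun y hy => (hm n hmn y hy).trans hn⟩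

theorem DeltaStabilizes.nonneg (hγ : DeltaStabilizes a x γ) {β : Ordinal.{0}} (hβ : β < ω₁) :
    0 ≤ γ β := by
  refine le_of_forall_pos_le_add fun η hη => ?_
  obtain ⟨n, hn⟩ := hγ.exists_forall_abs_sub_lt hβ hη
  have h₁ := (abs_lt.1 (hn _ (isBlockBasis_subseq _ strictMono_id))).2
  have h₂ := delta_nonneg (schreier a β) (normSeminorm ℝ X) fun i => x (n + id i)
  linarith

variable {e : ℕ → X}

theorem DeltaStabilizes.exists_mul_pow_le (ha : IsLimitChoice a) (he : LinearIndependent ℝ e)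
    (hx : IsBlockBasis e x) (hγ : DeltaStabilizes a x γ) {α : Ordinal.{0}} (hα : α < ω₁) {d : ℝ}
    (hd : 0 ≤ d) (h : d < ddotDelta (schreier a α) x) :
    ∃ κ > 0, ∀ n : ℕ, κ * d ^ n ≤ γ (α * (n : Ordinal.{0})) := by
  obtain ⟨p, z, ⟨c, C, hc, hcC⟩, hz, hdz⟩ := exists_lt_delta_of_lt_ddotDelta hd h
  have hreg := regular_schreier ha α hα
  -- The nonzero vector `x 0` forces `c ≤ C`.
  have hC : 0 < C := by
    have h0 : inClosedSpan x 0 ≠ 0 := fun h0 =>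
      hx.apply_ne_zero he (isBlockBasis_subseq x strictMono_id) 0
        (congrArg (Subtype.val : closedSpan x → X) h0)
    have h1 := norm_pos_iff.2 h0
    have h2 := (hcC (inClosedSpan x 0)).1.trans (hcC (inClosedSpan x 0)).2
    exact hc.trans_le (le_of_mul_le_mul_right h2 h1)
  have hest := lowerEstimate_of_lt_delta hreg hd hdz
  refine ⟨c / C, by positivity, fun n => ?_⟩
  have hβ := mul_natCast_lt_omega_one hα n
  have hest' : LowerEstimate (iterFamily (schreier a α) n)
      (coeffSeminorm (normSeminorm ℝ X) fun i => (z i : X)) (c / C * d ^ n) := by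
    refine (hest.iterFamily hd n).of_equivalent (pow_nonneg hd n) hC fun u => ?_
    have := hcC (comb z u)
    rw [Submodule.coe_norm, coe_comb] at this
    exact this
  obtain ⟨M, hM, hMF⟩ := schreier_mul_subseqLE ha hα n
  refine le_of_forall_pos_le_add fun η hη => ?_
  obtain ⟨k, hk⟩ := hγ.exists_forall_abs_sub_lt hβ hη
  have hblock := hz.coe.tail hM k
  have hshift : StrictMono fun i => k + i := fun i j h => by simpa using h
  -- Dropping the first `k` terms to reach the stabilized tail only spreads sets of `𝓢_{α·n}`, so
  -- the estimate survives.
  have hlow := hest'.comp_lmapDomain (𝓕 := schreier a (α * (n : Ordinal.{0})))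
    (M := fun i => M (k + i)) (hM.comp hshift) (fun F hF => by
      have : F.image (fun i => M (k + i)) = (F.image fun i => k + i).image M := by
        rw [Finset.image_image]
        rfl
      rw [this]
      exact hMF _ ((regular_schreier ha _ hβ).image_mem F hF F subset_rfl _
        (hshift.strictMonoOn _) fun m _ => Nat.le_add_left _ _))
  rw [← coeffSeminorm_comp] at hlow
  have hpos : 0 < normSeminorm ℝ X (z (M (k + 0)) : X) := by
    rw [coe_normSeminorm]
    exact norm_pos_iff.2 (hx.apply_ne_zero he hz.coe _)
  have h₁ := hlow.le_delta (regular_schreier ha _ hβ) hpos (by positivity)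
  have h₂ := (abs_lt.1 (hk _ hblock)).2
  linarith

theorem DeltaStabilizes.le_ddotDelta {e : SchauderBasis ℝ X} (ha : IsLimitChoice a)
    (hx : IsBlockBasis e.basis x) (hγ : DeltaStabilizes a x γ) {K : ℝ} (hK1 : 1 ≤ K)
    (hK : ∀ n, ‖e.proj n‖ ≤ K) {α : Ordinal.{0}} (hα : α < ω₁) {n : ℕ} {θ : ℝ} (hθ : 0 ≤ θ)
    (h : K * (1 + K) * θ ^ (n + 1) < γ (α * ((n + 1 : ℕ) : Ordinal.{0}))) :
    θ ≤ ddotDelta (schreier a α) x := by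
  rcases hθ.eq_or_lt with rfl | hθ0
  · exact ddotDelta_nonneg _ _
  have hreg := regular_schreier ha α hα
  have hβ := mul_natCast_lt_omega_one hα (n + 1)
  -- With this `d` the smallness condition of `exists_renorming` holds with equality.
  set d := K * (1 + K) * θ ^ (n + 1) with hd
  have hd0 : 0 < d := by positivity
  obtain ⟨k, hk⟩ := hγ.exists_forall_abs_sub_lt hβ (sub_pos.2 h)
  have hdelta := (abs_lt.1 (hk _ (isBlockBasis_subseq _ strictMono_id))).1
  have hest := lowerEstimate_of_lt_delta (regular_schreier ha _ hβ) hd0.le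
    (show d < _ by linarith)
  obtain ⟨M, hM, hMF⟩ := iterFamily_schreier_subseqLE ha hα (n + 1)
  have hM' : StrictMono fun i => k + M i := fun i j h => by simpa using hM h
  have hest' := hest.comp_lmapDomain hM hMF
  rw [← coeffSeminorm_comp] at hest'
  set P := coeffSeminorm (normSeminorm ℝ X) fun i => x (k + M i) with hP
  obtain ⟨N, C, hNC, hN⟩ := exists_renorming hreg (P := P) (K := K) (by linarith)
    (norm_comb_restrictInterval_le hK (hx.comp_strictMono hM')) hd0 hest' (NNReal.mk θ hθ) (by
      rw [hd, NNReal.coe_mk, mul_div_assoc', div_le_one hd0]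
      exact le_of_eq (by ring))
  obtain ⟨q, hq, hqN⟩ := exists_isEquivalentNorm_extension
    (Finsupp.linearCombination ℝ fun i => inClosedSpan x (k + M i)) N C fun c => by
      have : ‖Finsupp.linearCombination ℝ (fun i => inClosedSpan x (k + M i)) c‖ = P c := by
        change ‖comb (fun i => inClosedSpan x (k + M i)) c‖ = _
        rw [Submodule.coe_norm, coe_comb]
        rfl
      rw [this]
      exact hNC c
  have hqN' : coeffSeminorm q (fun i => inClosedSpan x (k + M i)) = N := Seminorm.ext hqN
  have hz : IsBlockBasis (inClosedSpan x) fun i => inClosedSpan x (k + M i) :=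
    isBlockBasis_subseq _ hM'
  refine le_trans ?_ (delta_le_ddotDelta hreg e.linearIndependent hx hq hz)
  refine LowerEstimate.le_delta hreg
    (delta_le_one_of_isEquivalentNorm hreg e.linearIndependent hx hq hz).2 hθ ?_
  rw [hqN']
  exact hN

end Stabilizing

end BlockBasis

/-! ### Passage to `n`-th roots. -/

theorem tendsto_const_rpow_one_div {A : ℝ} (hA : 0 < A) :
    Tendsto (fun n : ℕ => A ^ (1 / (n : ℝ))) atTop (𝓝 1) := by
  have := (Real.continuousAt_const_rpow (a := A) (b := 0) hA.ne').tendsto.comp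
    tendsto_one_div_atTop_nhds_zero_nat
  simpa [Function.comp_def] using this

theorem mul_pow_rpow_one_div {A D : ℝ} (hA : 0 ≤ A) (hD : 0 ≤ D) {n : ℕ} (hn : n ≠ 0) :
    (A * D ^ n) ^ (1 / (n : ℝ)) = A ^ (1 / (n : ℝ)) * D := by
  rw [Real.mul_rpow hA (by positivity), one_div, Real.pow_rpow_inv_natCast hD hn]

theorem tendsto_rpow_one_div_of_bounds {g : ℕ → ℝ} {D A : ℝ} (hg : ∀ n, 0 ≤ g n) (hD : 0 ≤ D)
    (hA : 0 < A) (hlow : ∀ d, 0 ≤ d → d < D → ∃ κ > 0, ∀ n, κ * d ^ n ≤ g n)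
    (hup : ∀ n θ, 0 ≤ θ → A * θ ^ (n + 1) < g (n + 1) → θ ≤ D) :
    Tendsto (fun n : ℕ => g n ^ (1 / (n : ℝ))) atTop (𝓝 D) := by
  have hup' : ∀ n, g (n + 1) ≤ A * D ^ (n + 1) := by
    intro n
    by_contra! hcon
    -- By continuity a strict inequality at `D` persists for some `θ > D`, against `hup`.
    have hcont : ContinuousAt (fun θ : ℝ => A * θ ^ (n + 1)) D := by fun_prop
    have hev : ∀ᶠ θ in 𝓝[>] D, A * θ ^ (n + 1) < g (n + 1) :=
      (hcont.eventually_lt_const hcon).filter_mono nhdsWithin_le_nhds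
    obtain ⟨θ, hθ, hDθ⟩ := (hev.and self_mem_nhdsWithin).exists
    have hDθ : D < θ := hDθ
    exact (hup n θ (hD.trans hDθ.le) hθ).not_gt hDθ
  refine tendsto_order.2 ⟨fun s hs => ?_, fun s hs => ?_⟩
  · rcases lt_or_ge s 0 with hs0 | hs0
    · exact Eventually.of_forall fun n => hs0.trans_le (Real.rpow_nonneg (hg n) _)
    · obtain ⟨d, hsd, hdD⟩ := exists_between hs
      obtain ⟨κ, hκ, h⟩ := hlow d (hs0.trans hsd.le) hdD
      have hlim := (tendsto_const_rpow_one_div hκ).mul_const d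
      rw [one_mul] at hlim
      filter_upwards [hlim.eventually_const_lt hsd, eventually_ne_atTop 0] with n hn hn0
      refine hn.trans_le ?_
      have hd : 0 ≤ d := hs0.trans hsd.le
      rw [← mul_pow_rpow_one_div hκ.le hd hn0]
      exact Real.rpow_le_rpow (by positivity) (h n) (by positivity)
  · have hlim := (tendsto_const_rpow_one_div hA).mul_const D
    rw [one_mul] at hlim
    filter_upwards [hlim.eventually_lt_const hs, eventually_ne_atTop 0] with n hn hn0
    refine lt_of_le_of_lt ?_ hn
    rw [← mul_pow_rpow_one_div hA.le hD hn0]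
    obtain ⟨m, rfl⟩ := Nat.exists_eq_succ_of_ne_zero hn0
    exact Real.rpow_le_rpow (hg _) (hup' m) (by positivity)

end AsymptoticL1

end

theorem proposition4p11 {X : Type*} [NormedAddCommGroup X] [NormedSpace ℝ X] [CompleteSpace X]
    (a : Ordinal.{0} → ℕ → Ordinal.{0}) (ha : AsymptoticL1.IsLimitChoice a)
    (e : SchauderBasis ℝ X) (γ : Ordinal.{0} → ℝ)
    (hγ : γ ∈ AsymptoticL1.deltaSpectrum a e.basis) :
    ∃ y : ℕ → X, AsymptoticL1.IsBlockBasis e.basis y ∧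
      AsymptoticL1.DeltaStabilizes a y γ ∧
      ∀ α < ω₁, Tendsto (fun n : ℕ => γ (α * (n : Ordinal.{0})) ^ (1 / (n : ℝ))) atTop
        (𝓝 (AsymptoticL1.ddotDelta (AsymptoticL1.schreier a α) y)) := by
  obtain ⟨x, hx, hxγ⟩ := hγ
  obtain ⟨K', hK'⟩ := e.exists_norm_proj_le
  have hK : ∀ n, ‖e.proj n‖ ≤ max K' 1 := fun n => (hK' n).trans (le_max_left _ _)
  have hK1 : 1 ≤ max K' 1 := le_max_right _ _
  refine ⟨x, hx, hxγ, fun α hα => ?_⟩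
  exact AsymptoticL1.tendsto_rpow_one_div_of_bounds
    (fun n => hxγ.nonneg (AsymptoticL1.mul_natCast_lt_omega_one hα n))
    (AsymptoticL1.ddotDelta_nonneg _ _) (A := max K' 1 * (1 + max K' 1)) (by positivity)
    (fun d hd h => hxγ.exists_mul_pow_le ha e.linearIndependent hx hα hd h)
    (fun n θ hθ h => hxγ.le_ddotDelta ha hx hK1 hK hα hθ h)
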